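/- Let $d_1,d_2,d'\ge 1$ be integers, $A=\mathbb R^{d'}$, $T>0$, $\epsilon>0$. Let $b:\mathbb R^{d_1}\times A\to\mathbb R^{d_1}$, $\ell:A\to\mathbb R$ and $L:\mathbb R^{d_1}\times\mathbb R^{d_2}\to\mathbb R$ satisfy the following assumptions. (i) All the derivatives $\nabla_x^k\nabla_a^l b$ with $k+l\le 4$ exist and are jointly continuous, there is $C\ge 0$ with $|\nabla_x^k\nabla_a^l b(x,a)|\le C(1+|a|^{k+1})(1+|x|^l)$ for all $(x,a)$ and all $k+l\le4$, and $b(x,0)=0$ for all $x$. (ii) $\ell$ is convex and twice continuously differentiable, and there is $c>0$ such that $\nabla^2\ell(a)\ge c(1+|a|^2)I_{d'}$ for all $a\in A$. Let $\nu^\infty(da)=e^{-\ell(a)}da/\int_A e^{-\ell(a')}da'$. (iii) $L$ is bounded from below and three times differentiable, and there is $C$ with $|L(x,y)|\le C(1+|x|^2+|y|^2)$ and $|\nabla^kL(x,y)|\le C(1+|x|+|y|)$ for all $(x,y)$ and $k=1,2,3$. (iv) (Discriminating property.) For all $\mathbb R^{d_1}$-valued random variables $X,Z$ on any probability space with $Z$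 integrable, if $\mathbb E[b(X,a)\cdot Z]=0$ for every $a\in A$, then $\mathbb E[Z\mid X]=0$ almost surely. For a probability measure $\nu$ on $A$ write $b(x,\nu)=\int_A b(x,a)\,d\nu(a)$, and let $\mathcal P_p$ be the set of Borel probability measures on $\mathbb R^{d_1}\times\mathbb R^{d_2}$ with finite moment of order $p$. Let $(t_0,\gamma_0)\in[0,T)\times\mathcal P_3$. A triple $(\nu_t,\gamma_t,u_t)_{t_0\le t\le T}$ is a solution of the first-order optimality system with initial condition $(t_0,\gamma_0)$ if: - $t\mapsto\nu_t$ is a measurable map from $[t_0,T]$ to the probability measures on $A$ such that $\int_{t_0}^T\mathcal E(\nu_t\mid\nu^\infty)\,dt<\infty$, where $\mathcal E$ is the relative entropy, and for every $t\in[t_0,T]$ the measure $\nu_t$ has the density $$\nu_t(a)=\frac1{z_t}\exp\Bigl(-\ell(a)-\frac1\epsilon\int_{\mathbb R^{d_1}\times\mathbb R^{d_2}} b(x,a)\cdot\nabla_xu_t(x,y)\,d\gamma_t(x,y)\Bigr),\qquad a\in A,$$ with $z_t$ the normalizing constant; - $\gamma\in\mathcal C([t_0,T],\mathcal P_2)$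 (for the Wasserstein distance of order 2), $\gamma_{t_0}=\gamma_0$, and $\partial_t\gamma_t+\operatorname{div}_x(b(x,\nu_t)\gamma_t)=0$ weakly, i.e. for every $t_1\in[t_0,T]$ and every $C^1$ function $\varphi$ of $(t,x,y)$ that is bounded together with its first derivatives, $$\int\varphi_{t_1}\,d\gamma_{t_1}=\int\varphi_{t_0}\,d\gamma_0+\int_{t_0}^{t_1}\!\int\bigl\{\partial_t\varphi_t(x,y)+b(x,\nu_t)\cdot\nabla_x\varphi_t(x,y)\bigr\}\,d\gamma_t(x,y)\,dt;$$ - $t\mapsto u_t$ is a $\tfrac12$-Hölder continuous curve on $[t_0,T]$ with values in the space $\mathcal C^1_{2,1}$ of $C^1$ functions $\varphi$ on $\mathbb R^{d_1}\times\mathbb R^{d_2}$ with $\sup\frac{|\varphi|}{1+|x|^2+|y|^2}+\sup\frac{|\nabla\varphi|}{1+|x|+|y|}<\infty$ (normed by this quantity), and it solves $-\partial_tu_t-b(x,\nu_t)\cdot\nabla_xu_t=0$, $u_T=L$, in the sense that for all $t\in[t_0,T]$ and all $(x,y)$, $$u_t(x,y)=L(x,y)+\int_t^T b(x,\nu_s)\cdot\nabla_xu_s(x,y)\,ds.$$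 **Proposition (no bifurcation).** Let $(\nu^1_t,\gamma^1_t,u^1_t)_{t_0\le t\le T}$ and $(\nu^2_t,\gamma^2_t,u^2_t)_{t_0\le t\le T}$ be two solutions of this system with the same initial condition $(t_0,\gamma_0)\in[0,T)\times\mathcal P_3$. If $\nu^1_{t_0}=\nu^2_{t_0}$, then $\nu^1_t=\nu^2_t$ for all $t\in[t_0,T]$; moreover $\gamma^1_t=\gamma^2_t$ and $u^1_t=u^2_t$ for all $t\in[t_0,T]$. -/

import Mathlib

open MeasureTheory Set Filter Topology
open scoped ENNReal

noncomputable section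

namespace MeanFieldResNet

/-- The Euclidean space of dimension `d`, with its Euclidean norm. -/
abbrev Eu (d : ℕ) : Type := EuclideanSpace ℝ (Fin d)

variable {d₁ d₂ d' : ℕ}

/-- The mixed derivative `∇_x^k ∇_a^l b` at `(x, a)`. -/
def mixedDeriv (b : Eu d₁ → Eu d' → Eu d₁) (k l : ℕ) (x : Eu d₁) (a : Eu d') :
    ContinuousMultilinearMap ℝ (fun _ : Fin k => Eu d₁)
      (ContinuousMultilinearMap ℝ (fun _ : Fin l => Eu d') (Eu d₁)) :=
  iteratedFDeriv ℝ k (fun x' => iteratedFDeriv ℝ l (b x') a) x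

/-- Assumption on the vector field: `b` is of class `C⁴` jointly (all the `∇_x^k ∇_a^l b`,
`k + l ≤ 4`, exist and are jointly continuous), with the stated growth, and `b(x, 0) = 0`. -/
structure RegularField (b : Eu d₁ → Eu d' → Eu d₁) : Prop where
  contDiff : ContDiff ℝ 4 (fun p : Eu d₁ × Eu d' => b p.1 p.2)
  growth : ∃ C : ℝ, 0 ≤ C ∧ ∀ k l : ℕ, k + l ≤ 4 → ∀ x a,
    ‖mixedDeriv b k l x a‖ ≤ C * (1 + ‖a‖ ^ (k + 1)) * (1 + ‖x‖ ^ l)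
  zero : ∀ x, b x 0 = 0

/-- Assumption on the potential: `ℓ` is convex, of class `C²`, and
`∇²ℓ(a) ≥ c (1 + |a|²) I` for some `c > 0`. -/
structure RegularPotential (ℓ : Eu d' → ℝ) : Prop where
  contDiff : ContDiff ℝ 2 ℓ
  convex : ConvexOn ℝ univ ℓ
  hessian : ∃ c : ℝ, 0 < c ∧ ∀ a v,
    c * (1 + ‖a‖ ^ 2) * ‖v‖ ^ 2 ≤ fderiv ℝ (fderiv ℝ ℓ) a v v

/-- Assumption on the terminal cost: `L` is bounded from below, three times differentiable,
with quadratic growth of `L` and linear growth of its first three derivatives. (The norms of the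
derivatives refer to the product norm, equivalent to the Euclidean one.) -/
structure RegularCost (L : Eu d₁ × Eu d₂ → ℝ) : Prop where
  bddBelow : ∃ m : ℝ, ∀ p, m ≤ L p
  contDiff_two : ContDiff ℝ 2 L
  differentiable_three : Differentiable ℝ (iteratedFDeriv ℝ 2 L)
  growth : ∃ C : ℝ, ∀ p,
    |L p| ≤ C * (1 + ‖p.1‖ ^ 2 + ‖p.2‖ ^ 2) ∧
    ∀ k ∈ ({1, 2, 3} : Set ℕ), ‖iteratedFDeriv ℝ k L p‖ ≤ C * (1 + ‖p.1‖ + ‖p.2‖)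

/-- Discriminating property: for random variables `X`, `Z` with `Z` integrable, if
`E[b(X, a) · Z] = 0` for all `a` then `E[Z | X] = 0` almost surely. -/
def Discriminating (b : Eu d₁ → Eu d' → Eu d₁) : Prop :=
  ∀ (Ω : Type) [MeasurableSpace Ω] (P : Measure Ω) [IsProbabilityMeasure P] (X Z : Ω → Eu d₁),
    Measurable X → Measurable Z → Integrable Z P →
    (∀ a, ∫ ω, inner ℝ (b (X ω) a) (Z ω) ∂P = 0) →
    P[Z | MeasurableSpace.comap X inferInstance] =ᵐ[P] 0

/-- The Gibbs probability measure `z⁻¹ exp(-f(a)) da`, where `z = ∫ exp(-f(a)) da`. -/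
def gibbs (f : Eu d' → ℝ) : Measure (Eu d') :=
  (volume : Measure (Eu d')).tilted (fun a => -f a)

/-- Admissible controls on `[t₀, T]`: measurable maps `t ↦ ν_t` into the probability measures on
the parameter space with `∫_{t₀}^T Ent(ν_t | ν^∞) dt < ∞`, where `ν^∞ ∝ exp(-ℓ)`.
Values outside `[t₀, T]` are irrelevant. -/
structure AdmissibleControl (ℓ : Eu d' → ℝ) (t₀ T : ℝ)
    (ν : ℝ → ProbabilityMeasure (Eu d')) : Prop where
  measurable : Measurable (fun t : Icc t₀ T => (ν t : Measure (Eu d')))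
  entropy : ∫⁻ t in Icc t₀ T, InformationTheory.klDiv (ν t : Measure (Eu d')) (gibbs ℓ) < ∞

/-- The averaged field `b(x, ν) = ∫ b(x, a) dν(a)`. -/
def avg (b : Eu d₁ → Eu d' → Eu d₁) (x : Eu d₁) (ν : ProbabilityMeasure (Eu d')) : Eu d₁ :=
  ∫ a, b x a ∂(ν : Measure (Eu d'))

/-- The partial gradient `∇_x φ(x, y)` at `p = (x, y)`. -/
def gradX (φ : Eu d₁ × Eu d₂ → ℝ) (p : Eu d₁ × Eu d₂) : Eu d₁ :=
  gradient (fun x => φ (x, p.2)) p.1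

/-- Finite moment of order `p`, i.e. membership in `P_p`. -/
def FiniteMoment (p : ℝ≥0∞) (μ : ProbabilityMeasure (Eu d₁ × Eu d₂)) : Prop :=
  MemLp (fun z : Eu d₁ × Eu d₂ => z) p (μ : Measure (Eu d₁ × Eu d₂))

/-- The Monge-Kantorovich-Rubinstein (Wasserstein) distance of order 2, for the Euclidean
distance on the product. -/
def wass₂ (μ μ' : ProbabilityMeasure (Eu d₁ × Eu d₂)) : ℝ≥0∞ :=
  (⨅ (π : Measure ((Eu d₁ × Eu d₂) × (Eu d₁ × Eu d₂)))
    (_ : π.map Prod.fst = (μ : Measure (Eu d₁ × Eu d₂)) ∧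
      π.map Prod.snd = (μ' : Measure (Eu d₁ × Eu d₂))),
    ∫⁻ q, (‖q.1.1 - q.2.1‖ₑ ^ 2 + ‖q.1.2 - q.2.2‖ₑ ^ 2) ∂π) ^ (1 / 2 : ℝ)

/-- `γ ∈ C([t₀, T], P₂)`. -/
structure ContinuousCurve (t₀ T : ℝ) (γ : ℝ → ProbabilityMeasure (Eu d₁ × Eu d₂)) : Prop where
  moment : ∀ t ∈ Icc t₀ T, FiniteMoment 2 (γ t)
  continuous : ∀ s ∈ Icc t₀ T, Tendsto (fun t => wass₂ (γ t) (γ s)) (𝓝[Icc t₀ T] s) (𝓝 0)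

/-- Test functions: `φ(t, x, y)` of class `C¹`, bounded together with its first derivatives. -/
structure TestFunction (φ : ℝ × Eu d₁ × Eu d₂ → ℝ) : Prop where
  contDiff : ContDiff ℝ 1 φ
  bounded : ∃ C : ℝ, ∀ p, |φ p| ≤ C ∧ ‖fderiv ℝ φ p‖ ≤ C

/-- `γ` solves `∂_t γ_t + div_x (b(x, ν_t) γ_t) = 0` on `[t₀, T]` with `γ_{t₀} = γ₀`: it is a
continuous curve in `P₂` and the equation holds against all test functions. -/
structure SolvesContinuity (b : Eu d₁ → Eu d' → Eu d₁) (t₀ T : ℝ)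
    (γ₀ : ProbabilityMeasure (Eu d₁ × Eu d₂)) (ν : ℝ → ProbabilityMeasure (Eu d'))
    (γ : ℝ → ProbabilityMeasure (Eu d₁ × Eu d₂)) : Prop where
  curve : ContinuousCurve t₀ T γ
  initial : γ t₀ = γ₀
  weak : ∀ φ : ℝ × Eu d₁ × Eu d₂ → ℝ, TestFunction φ → ∀ t₁ ∈ Icc t₀ T,
    ∫ p, φ (t₁, p.1, p.2) ∂(γ t₁ : Measure (Eu d₁ × Eu d₂)) =
      ∫ p, φ (t₀, p.1, p.2) ∂(γ₀ : Measure (Eu d₁ × Eu d₂)) +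
      ∫ t in t₀..t₁, ∫ p, (deriv (fun s => φ (s, p.1, p.2)) t +
          inner ℝ (avg b p.1 (ν t)) (gradX (fun q => φ (t, q.1, q.2)) p))
        ∂(γ t : Measure (Eu d₁ × Eu d₂))

/-- `|φ(x, y)| ≤ K (1 + |x|² + |y|²)` and `|∇φ(x, y)| ≤ K (1 + |x| + |y|)` for all `(x, y)`:
up to a multiplicative constant, `K` bounds the norm of `φ` in `C¹_{2,1}`. -/
def GrowthBound (K : ℝ) (φ : Eu d₁ × Eu d₂ → ℝ) : Prop :=
  ∀ p, |φ p| ≤ K * (1 + ‖p.1‖ ^ 2 + ‖p.2‖ ^ 2) ∧ ‖fderiv ℝ φ p‖ ≤ K * (1 + ‖p.1‖ + ‖p.2‖)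

/-- `u` solves `-∂_t u_t - b(x, ν_t) · ∇_x u_t = 0` on `[t₀, T]` with `u_T = L`: it is a
`1/2`-Hölder continuous curve in `C¹_{2,1}` and the equation holds in integral form. -/
structure SolvesTransport (b : Eu d₁ → Eu d' → Eu d₁) (L : Eu d₁ × Eu d₂ → ℝ) (t₀ T : ℝ)
    (ν : ℝ → ProbabilityMeasure (Eu d')) (u : ℝ → Eu d₁ × Eu d₂ → ℝ) : Prop where
  contDiff : ∀ t ∈ Icc t₀ T, ContDiff ℝ 1 (u t)
  growth : ∀ t ∈ Icc t₀ T, ∃ K : ℝ, GrowthBound K (u t)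
  holder : ∃ K : ℝ, ∀ s ∈ Icc t₀ T, ∀ t ∈ Icc t₀ T,
    GrowthBound (K * Real.sqrt |t - s|) (fun p => u t p - u s p)
  equation : ∀ t ∈ Icc t₀ T, ∀ p,
    u t p = L p + ∫ s in t..T, inner ℝ (avg b p.1 (ν s)) (gradX (u s) p)

/-- `(ν, γ, u)` solves the first-order optimality system with initial condition `(t₀, γ₀)`:
`ν` is an admissible control with
`ν_t(a) = z_t⁻¹ exp(-ℓ(a) - ε⁻¹ ∫ b(x, a) · ∇_x u_t(x, y) dγ_t(x, y))` for every `t ∈ [t₀, T]`,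
`γ` solves the continuity equation and `u` the backward transport equation driven by `ν`. -/
structure SolvesOptimalitySystem (b : Eu d₁ → Eu d' → Eu d₁) (ℓ : Eu d' → ℝ)
    (L : Eu d₁ × Eu d₂ → ℝ) (ε t₀ T : ℝ) (γ₀ : ProbabilityMeasure (Eu d₁ × Eu d₂))
    (ν : ℝ → ProbabilityMeasure (Eu d')) (γ : ℝ → ProbabilityMeasure (Eu d₁ × Eu d₂))
    (u : ℝ → Eu d₁ × Eu d₂ → ℝ) : Prop where
  admissible : AdmissibleControl ℓ t₀ T ν
  control : ∀ t ∈ Icc t₀ T, (ν t : Measure (Eu d')) =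
    gibbs (fun a => ℓ a +
      1 / ε * ∫ p, inner ℝ (b p.1 a) (gradX (u t) p) ∂(γ t : Measure (Eu d₁ × Eu d₂)))
  curve : SolvesContinuity b t₀ T γ₀ ν γ
  multiplier : SolvesTransport b L t₀ T ν u

end MeanFieldResNet

end

/-!
Along a solution `(ν, γ, u)` the control `ν t` is the Gibbs measure of the energy
`f t a = ℓ a + ε⁻¹ ∫ b(x, a) · ∇ₓu t dγ t`, so the averaged field `v t x = b(x, ν t)` is bounded,
continuous in `t` and `C¹` in `x` with Lipschitz derivative (`RegularField.regularVectorField`). It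
has a flow `X t`, differentiable in space, and the inverse `M t x` of the derivative of `X t` at `x`
solves `M' = -M ∘ ∇ₓv(X)`. By the method of characteristics `γ t` is the image of `γ₀` under
`(x, y) ↦ (X t x, y)` (`SolvesContinuity.eq_map_flow`) and `u t (X t x, y) = u t₀ (x, y)`
(`SolvesTransport.apply_flow`). Differentiating the last identity in `x` gives
(`SolvesOptimalitySystem.energy_eq`)
`f t a = ℓ a + ε⁻¹ ∫ M t x (b(X t x, a)) · ζ(x, y) dγ₀(x, y)`, where `ζ = ∇ₓu t₀`.

In this formula `ζ` is integrated against a function of `x` only, so it may be replaced by its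
conditional expectation given `x`. For two solutions with `ν₁ t₀ = ν₂ t₀`, the energies at time `t₀`
agree, because a Gibbs measure determines its energy up to a constant and `b(x, 0) = 0`; hence
`∫ b(x, a) · (ζ₁ - ζ₂) dγ₀ = 0` for all `a`, and the discriminating property says precisely that
`ζ₁` and `ζ₂` have the same conditional expectation (`Discriminating.integral_inner_eq`). The pairs
`(X, M)` of both solutions therefore solve the same closed system of equations in the forward
direction, with the same initial condition. The field of this system depends on `(X, M)` in a
Lipschitz way (`LinearPerturbation.exists_gibbs_lipschitz`, `abs_integral_inner_sub_le`), so the two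
pairs coincide (`RegularVectorField.flow_eq_of_closed_loop`), and with them `ν`, `γ` and `u`.
-/

noncomputable section

namespace MeanFieldResNet

section ODE

variable {E : Type*} [NormedAddCommGroup E] [NormedSpace ℝ E]

/-! ### Global solutions of ordinary differential equations -/

lemma norm_intervalIntegral_le_exp {g : ℝ → E} {c m s : ℝ} (hm : 0 < m)
    (hg : ∀ τ, ‖g τ‖ ≤ c * Real.exp (m * |τ - s|)) (t : ℝ) :
    ‖∫ τ in s..t, g τ‖ ≤ c / m * Real.exp (m * |t - s|) := by
  have hc : 0 ≤ c := by
    have := (norm_nonneg _).trans (hg s)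
    simpa using this
  have key : ∀ σ : ℝ, σ ^ 2 = 1 → ∀ a b : ℝ, a ≤ b → (∀ τ ∈ Icc a b, σ * (τ - s) = |τ - s|) →
      ‖∫ τ in a..b, g τ‖ ≤
        c / (σ * m) * Real.exp (m * |b - s|) - c / (σ * m) * Real.exp (m * |a - s|) := by
    intro σ hσ a b hab h
    have hσ0 : σ ≠ 0 := by rintro rfl; norm_num at hσ
    have hd : ∀ τ, HasDerivAt (fun τ => c / (σ * m) * Real.exp (m * (σ * (τ - s))))
        (c * Real.exp (m * (σ * (τ - s)))) τ := by
      intro τ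
      have h1 : HasDerivAt (fun τ : ℝ => m * (σ * (τ - s))) (m * (σ * 1)) τ :=
        (((hasDerivAt_id τ).sub_const s).const_mul σ).const_mul m
      convert! (h1.exp.const_mul (c / (σ * m))) using 1
      field_simp
    have hcont : Continuous fun τ => c * Real.exp (m * (σ * (τ - s))) := by fun_prop
    calc ‖∫ τ in a..b, g τ‖ ≤ ∫ τ in a..b, c * Real.exp (m * (σ * (τ - s))) := by
          apply intervalIntegral.norm_integral_le_of_norm_le hab _ (hcont.intervalIntegrable _ _)
          filter_upwards with τ hτ
          rw [h τ ⟨hτ.1.le, hτ.2⟩]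
          exact hg τ
      _ = _ := by
          rw [intervalIntegral.integral_eq_sub_of_hasDerivAt (fun τ _ => hd τ)
            (hcont.intervalIntegrable _ _), h a ⟨le_rfl, hab⟩, h b ⟨hab, le_rfl⟩]
  rcases le_total s t with hst | hst
  · have := key 1 (by norm_num) s t hst (fun τ hτ => by
      rw [abs_of_nonneg (sub_nonneg.2 hτ.1), one_mul])
    have h2 : 0 ≤ c / (1 * m) * Real.exp (m * |s - s|) := by positivity
    rw [one_mul] at *
    linarith
  · have := key (-1) (by norm_num) t s hst (fun τ hτ => by
      rw [abs_of_nonpos (sub_nonpos.2 hτ.2), neg_one_mul])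
    have h2 : 0 ≤ c / m * Real.exp (m * |s - s|) := by positivity
    rw [neg_one_mul, div_neg] at this
    rw [intervalIntegral.integral_symm, norm_neg]
    linarith

/-- Picard's theorem, global in time: the Picard map is a contraction in the norm
`sup_t e^{-m |t - s|} ‖α t - x₀‖` as soon as `m` exceeds the Lipschitz constant. -/
theorem exists_global_solution [CompleteSpace E] {f : ℝ → E → E}
    (hf : Continuous fun p : ℝ × E => f p.1 p.2) {K C : ℝ} (hK : 0 ≤ K)
    (hLip : ∀ t x y, ‖f t x - f t y‖ ≤ K * ‖x - y‖) (s : ℝ) (x₀ : E) (hC : ∀ t, ‖f t x₀‖ ≤ C) :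
    ∃ α : ℝ → E, α s = x₀ ∧ ∀ t, HasDerivAt α (f t (α t)) t := by
  set m : ℝ := 2 * K + 1 with hm
  have hm0 : 0 < m := by positivity
  have hC0 : 0 ≤ C := (norm_nonneg _).trans (hC s)
  let w : ℝ → ℝ := fun t => Real.exp (m * |t - s|)
  have hw : Continuous w := by fun_prop
  have hw1 : ∀ t, 1 ≤ w t := fun t => Real.one_le_exp (by positivity)
  let g : (BoundedContinuousFunction ℝ E) → ℝ → E := fun β τ => f τ (x₀ + w τ • β τ)
  have hg : ∀ β, Continuous (g β) := fun β =>
    hf.comp (continuous_id.prodMk (continuous_const.add (hw.smul β.continuous)))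
  have hgd : ∀ β β' τ, ‖g β τ - g β' τ‖ ≤ (K * ‖β - β'‖) * w τ := by
    intro β β' τ
    refine (hLip _ _ _).trans ?_
    have : (x₀ + w τ • β τ) - (x₀ + w τ • β' τ) = w τ • (β - β') τ := by
      simp [smul_sub]
    rw [this, norm_smul, Real.norm_of_nonneg (by positivity : 0 ≤ w τ)]
    have h := (β - β').norm_coe_le_norm τ
    calc K * (w τ * ‖(β - β') τ‖) ≤ K * (w τ * ‖β - β'‖) := by gcongr
      _ = _ := by ring
  have hgb : ∀ β τ, ‖g β τ‖ ≤ (K * ‖β‖ + C) * w τ := by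
    intro β τ
    have h0 : ‖g 0 τ‖ ≤ C * w τ := by
      have : g 0 τ = f τ x₀ := by simp [g]
      rw [this]
      exact (hC τ).trans (le_mul_of_one_le_right hC0 (hw1 τ))
    have h1 := hgd β 0 τ
    rw [sub_zero] at h1
    calc ‖g β τ‖ = ‖(g β τ - g 0 τ) + g 0 τ‖ := by rw [sub_add_cancel]
      _ ≤ ‖g β τ - g 0 τ‖ + ‖g 0 τ‖ := norm_add_le _ _
      _ ≤ _ := by rw [add_mul]; gcongr
  let P : BoundedContinuousFunction ℝ E → BoundedContinuousFunction ℝ E := fun β =>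
    BoundedContinuousFunction.ofNormedAddCommGroup (fun t => (w t)⁻¹ • ∫ τ in s..t, g β τ)
      ((hw.inv₀ (fun t => (by positivity : w t ≠ 0))).smul
        (intervalIntegral.continuous_primitive (fun _ _ => (hg β).intervalIntegrable _ _) s))
      ((K * ‖β‖ + C) / m) (fun t => by
        have := norm_intervalIntegral_le_exp hm0 (hgb β) t
        rw [norm_smul, norm_inv, Real.norm_of_nonneg (by positivity : 0 ≤ w t), inv_mul_le_iff₀
          (by positivity : 0 < w t), mul_comm]
        exact this)
  have hP : ∀ β t, P β t = (w t)⁻¹ • ∫ τ in s..t, g β τ := fun β t => rfl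
  have hcontr : ContractingWith (1 / 2) P := by
    refine ⟨by rw [← NNReal.coe_lt_coe]; norm_num, LipschitzWith.of_dist_le_mul fun β β' => ?_⟩
    rw [BoundedContinuousFunction.dist_le (by positivity)]
    intro t
    rw [dist_eq_norm, hP, hP, ← smul_sub, ← intervalIntegral.integral_sub
      ((hg β).intervalIntegrable _ _) ((hg β').intervalIntegrable _ _), norm_smul, norm_inv,
      Real.norm_of_nonneg (by positivity : 0 ≤ w t), inv_mul_le_iff₀ (by positivity : 0 < w t)]
    refine (norm_intervalIntegral_le_exp hm0 (hgd β β') t).trans ?_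
    rw [mul_comm, dist_eq_norm]
    have : K * ‖β - β'‖ / m ≤ (1 / 2 : ℝ) * ‖β - β'‖ := by
      rw [div_le_iff₀ hm0]
      nlinarith [norm_nonneg (β - β')]
    have h3 : ((1 / 2 : NNReal) : ℝ) = 1 / 2 := by norm_num
    rw [h3]
    gcongr
  set β := hcontr.fixedPoint with hβ
  have hfix : P β = β := hcontr.fixedPoint_isFixedPt
  have hα : ∀ t, x₀ + w t • β t = x₀ + ∫ τ in s..t, g β τ := by
    intro t
    conv_lhs => rw [← hfix]
    rw [hP, smul_inv_smul₀ (by positivity : w t ≠ 0)]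
  refine ⟨fun t => x₀ + w t • β t, by simp [hα], fun t => ?_⟩
  have h := ((intervalIntegral.integral_hasDerivAt_right ((hg β).intervalIntegrable s t)
    ((hg β).stronglyMeasurableAtFilter _ _) (hg β).continuousAt).const_add x₀)
  exact h.congr_of_eventuallyEq (Eventually.of_forall hα)

/-- Grönwall's inequality, forwards and backwards in time. -/
lemma norm_le_of_norm_deriv_le {f f' : ℝ → E} {K ε s t : ℝ} (hK : 0 ≤ K) (hε : 0 ≤ ε)
    (hf : ∀ τ, HasDerivAt f (f' τ) τ) (bound : ∀ τ ∈ uIcc s t, ‖f' τ‖ ≤ K * ‖f τ‖ + ε) :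
    ‖f t‖ ≤ (‖f s‖ + ε * |t - s|) * Real.exp (K * |t - s|) := by
  have hg : ∀ x : ℝ, 0 ≤ x →
      gronwallBound ‖f s‖ K ε x ≤ (‖f s‖ + ε * x) * Real.exp (K * x) := by
    intro x hx
    rcases hK.eq_or_lt with rfl | hK'
    · simp [gronwallBound_K0]
    · rw [gronwallBound_of_K_ne_0 hK'.ne', add_mul]
      have h1 : Real.exp (K * x) - 1 ≤ K * x * Real.exp (K * x) := by
        have := Real.add_one_le_exp (-(K * x))
        have h2 : Real.exp (-(K * x)) * Real.exp (K * x) = 1 := by rw [← Real.exp_add]; simp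
        nlinarith [Real.exp_pos (K * x)]
      have : ε / K * (Real.exp (K * x) - 1) ≤ ε / K * (K * x * Real.exp (K * x)) := by gcongr
      have h3 : ε / K * (K * x * Real.exp (K * x)) = ε * x * Real.exp (K * x) := by
        field_simp
      simp only
      linarith
  rcases le_total s t with hst | hst
  · rw [abs_of_nonneg (sub_nonneg.2 hst)]
    refine le_trans ?_ (hg _ (sub_nonneg.2 hst))
    exact norm_le_gronwallBound_of_norm_deriv_right_le
      (fun τ _ => (hf τ).continuousAt.continuousWithinAt) (fun τ _ => (hf τ).hasDerivWithinAt)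
      le_rfl (fun τ hτ => bound τ (by rw [uIcc_of_le hst]; exact ⟨hτ.1, hτ.2.le⟩)) t
      ⟨hst, le_rfl⟩
  · rw [abs_of_nonpos (sub_nonpos.2 hst)]
    refine le_trans ?_ (hg _ (by linarith))
    have hd : ∀ τ, HasDerivAt (fun τ => f (-τ)) (-f' (-τ)) τ := fun τ => by
      have h := (hf (-τ)).scomp τ (hasDerivAt_neg τ)
      rw [neg_one_smul] at h
      exact h
    have := norm_le_gronwallBound_of_norm_deriv_right_le (f := fun τ => f (-τ)) (a := -s) (b := -t)
      (δ := ‖f s‖) (K := K) (ε := ε)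
      (fun τ _ => (hd τ).continuousAt.continuousWithinAt) (fun τ _ => (hd τ).hasDerivWithinAt)
      (by simp) (fun τ hτ => by
        rw [norm_neg]
        exact bound (-τ) (by rw [uIcc_of_ge hst]; constructor <;> linarith [hτ.1, hτ.2])) (-t)
      ⟨by linarith, le_rfl⟩
    simpa [neg_add_eq_sub, sub_eq_add_neg, add_comm] using this

/-! ### Flows of regular vector fields -/

/-- A time-dependent vector field `v` on `E`, bounded by `K`, continuous in time and space, whose
space derivative `A` is continuous in time and space, bounded by `K` and `K`-Lipschitz in space. -/
structure RegularVectorField (v : ℝ → E → E) (A : ℝ → E → E →L[ℝ] E) (K : ℝ) : Prop where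
  continuous : Continuous fun p : ℝ × E => v p.1 p.2
  norm_le : ∀ t x, ‖v t x‖ ≤ K
  hasFDerivAt : ∀ t x, HasFDerivAt (v t) (A t x) x
  continuous_deriv : Continuous fun p : ℝ × E => A p.1 p.2
  norm_deriv_le : ∀ t x, ‖A t x‖ ≤ K
  lipschitz_deriv : ∀ t x y, ‖A t x - A t y‖ ≤ K * ‖x - y‖

namespace RegularVectorField

variable {v : ℝ → E → E} {A : ℝ → E → E →L[ℝ] E} {K : ℝ}

lemma nonneg (hv : RegularVectorField v A K) : 0 ≤ K :=
  (norm_nonneg _).trans (hv.norm_le 0 0)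

lemma lipschitz (hv : RegularVectorField v A K) (t : ℝ) (x y : E) :
    ‖v t x - v t y‖ ≤ K * ‖x - y‖ :=
  convex_univ.norm_image_sub_le_of_norm_hasFDerivWithin_le
    (fun z _ => (hv.hasFDerivAt t z).hasFDerivWithinAt) (fun z _ => hv.norm_deriv_le t z)
    (mem_univ y) (mem_univ x)

lemma norm_sub_sub_le (hv : RegularVectorField v A K) (t : ℝ) (x y : E) :
    ‖v t y - v t x - A t x (y - x)‖ ≤ K * ‖y - x‖ ^ 2 := by
  have h := (convex_closedBall x ‖y - x‖).norm_image_sub_le_of_norm_hasFDerivWithin_le'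
    (f := v t) (φ := A t x) (C := K * ‖y - x‖) (x := x) (y := y)
    (fun z _ => (hv.hasFDerivAt t z).hasFDerivWithinAt)
    (fun z hz => (hv.lipschitz_deriv t z x).trans (by
      have := hv.nonneg
      rw [mem_closedBall_iff_norm] at hz
      gcongr)) (by simp) (by simp [dist_eq_norm])
  rwa [sq, ← mul_assoc]

lemma norm_sub_le_of_integralCurve (hv : RegularVectorField v A K) {α β : ℝ → E}
    (hα : ∀ t, HasDerivAt α (v t (α t)) t) (hβ : ∀ t, HasDerivAt β (v t (β t)) t) (s t : ℝ) :
    ‖α t - β t‖ ≤ ‖α s - β s‖ * Real.exp (K * |t - s|) := by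
  have := norm_le_of_norm_deriv_le (s := s) (t := t) hv.nonneg le_rfl
    (fun τ => (hα τ).sub (hβ τ)) (fun τ _ => by simpa using hv.lipschitz τ (α τ) (β τ))
  simpa using this

lemma continuous_along (hv : RegularVectorField v A K) {α : ℝ → E} (hα : Continuous α) :
    Continuous fun t => A t (α t) :=
  hv.continuous_deriv.comp (continuous_id.prodMk hα)

lemma norm_comp_le (hv : RegularVectorField v A K) (m : E →L[ℝ] E) (t : ℝ) (x : E) :
    ‖m ∘L A t x‖ ≤ K * ‖m‖ := by
  rw [mul_comm]
  exact (ContinuousLinearMap.opNorm_comp_le _ _).trans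
    (mul_le_mul_of_nonneg_left (hv.norm_deriv_le _ _) (norm_nonneg _))

variable [CompleteSpace E]

lemma exists_flow (hv : RegularVectorField v A K) (s : ℝ) (x : E) :
    ∃ α : ℝ → E, α s = x ∧ ∀ t, HasDerivAt α (v t (α t)) t :=
  exists_global_solution hv.continuous hv.nonneg hv.lipschitz s x (fun t => hv.norm_le t x)

/-- The position at time `t` of the integral curve of `v` that is at `x` at time `s`. -/
def flow (hv : RegularVectorField v A K) (s t : ℝ) (x : E) : E :=
  Classical.choose (hv.exists_flow s x) t

@[simp]
lemma flow_self (hv : RegularVectorField v A K) (s : ℝ) (x : E) : hv.flow s s x = x :=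
  (Classical.choose_spec (hv.exists_flow s x)).1

lemma hasDerivAt_flow (hv : RegularVectorField v A K) (s t : ℝ) (x : E) :
    HasDerivAt (fun t => hv.flow s t x) (v t (hv.flow s t x)) t :=
  (Classical.choose_spec (hv.exists_flow s x)).2 t

lemma flow_eq_of_integralCurve (hv : RegularVectorField v A K) {α : ℝ → E}
    (hα : ∀ t, HasDerivAt α (v t (α t)) t) (s t : ℝ) : hv.flow s t (α s) = α t := by
  have := hv.norm_sub_le_of_integralCurve (fun t => hv.hasDerivAt_flow s t (α s)) hα s t
  rw [flow_self, sub_self, norm_zero, zero_mul] at this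
  exact sub_eq_zero.1 (norm_le_zero_iff.1 this)

lemma flow_flow (hv : RegularVectorField v A K) (r s t : ℝ) (x : E) :
    hv.flow s t (hv.flow r s x) = hv.flow r t x :=
  hv.flow_eq_of_integralCurve (fun t => hv.hasDerivAt_flow r t x) s t

lemma lipschitz_flow (hv : RegularVectorField v A K) (s t : ℝ) (x y : E) :
    ‖hv.flow s t x - hv.flow s t y‖ ≤ ‖x - y‖ * Real.exp (K * |t - s|) := by
  simpa using hv.norm_sub_le_of_integralCurve (fun t => hv.hasDerivAt_flow s t x)
    (fun t => hv.hasDerivAt_flow s t y) s t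

lemma continuous_flow_right (hv : RegularVectorField v A K) (s t : ℝ) :
    Continuous (hv.flow s t) :=
  (LipschitzWith.of_dist_le_mul (K := (Real.exp (K * |t - s|)).toNNReal) fun x y => by
    rw [dist_eq_norm, dist_eq_norm, Real.coe_toNNReal _ (Real.exp_pos _).le, mul_comm]
    exact hv.lipschitz_flow s t x y).continuous

lemma norm_flow_sub_le (hv : RegularVectorField v A K) (s t : ℝ) (x : E) :
    ‖hv.flow s t x - x‖ ≤ K * |t - s| := by
  have := convex_univ.norm_image_sub_le_of_norm_hasDerivWithin_le (C := K)
    (fun τ _ => (hv.hasDerivAt_flow s τ x).hasDerivWithinAt) (fun τ _ => hv.norm_le _ _)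
    (mem_univ s) (mem_univ t)
  simpa using this

lemma continuous_flow_mid (hv : RegularVectorField v A K) (s : ℝ) (x : E) :
    Continuous fun t => hv.flow s t x :=
  continuous_iff_continuousAt.2 fun t => (hv.hasDerivAt_flow s t x).continuousAt

lemma exists_invDeriv (hv : RegularVectorField v A K) (s : ℝ) (x : E) :
    ∃ M : ℝ → E →L[ℝ] E, M s = ContinuousLinearMap.id ℝ E ∧
      ∀ t, HasDerivAt M (-(M t ∘L A t (hv.flow s t x))) t := by
  refine exists_global_solution (f := fun t m => -(m ∘L A t (hv.flow s t x))) (K := K) (C := K)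
    ?_ hv.nonneg ?_ s (ContinuousLinearMap.id ℝ E) ?_
  · exact (continuous_snd.clm_comp
      ((hv.continuous_along (hv.continuous_flow_mid s x)).comp continuous_fst)).neg
  · intro t m m'
    rw [neg_sub_neg, ← ContinuousLinearMap.sub_comp, norm_sub_rev m m', mul_comm]
    exact (ContinuousLinearMap.opNorm_comp_le _ _).trans
      (mul_le_mul_of_nonneg_left (hv.norm_deriv_le _ _) (norm_nonneg _))
  · intro t
    rw [ContinuousLinearMap.id_comp, norm_neg]
    exact hv.norm_deriv_le _ _

/-- The inverse of the space derivative of `flow s t` at `x`, defined as the solution of the linear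
equation `∂ₜ M = -M ∘ A(t, flow s t x)`, `M = id` at `t = s`. -/
def invDeriv (hv : RegularVectorField v A K) (s t : ℝ) (x : E) : E →L[ℝ] E :=
  Classical.choose (hv.exists_invDeriv s x) t

lemma invDeriv_self (hv : RegularVectorField v A K) (s : ℝ) (x : E) :
    hv.invDeriv s s x = ContinuousLinearMap.id ℝ E :=
  (Classical.choose_spec (hv.exists_invDeriv s x)).1

lemma hasDerivAt_invDeriv (hv : RegularVectorField v A K) (s t : ℝ) (x : E) :
    HasDerivAt (fun t => hv.invDeriv s t x)
      (-(hv.invDeriv s t x ∘L A t (hv.flow s t x))) t :=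
  (Classical.choose_spec (hv.exists_invDeriv s x)).2 t

lemma norm_invDeriv_le (hv : RegularVectorField v A K) (s t : ℝ) (x : E) :
    ‖hv.invDeriv s t x‖ ≤ Real.exp (K * |t - s|) := by
  have := norm_le_of_norm_deriv_le (s := s) (t := t) hv.nonneg le_rfl
    (fun τ => hv.hasDerivAt_invDeriv s τ x)
    (fun τ _ => by rw [norm_neg, add_zero]; exact hv.norm_comp_le _ _ _)
  rw [zero_mul, add_zero, invDeriv_self] at this
  exact this.trans (mul_le_of_le_one_left (Real.exp_pos _).le ContinuousLinearMap.norm_id_le)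

lemma norm_invDeriv_sub_le (hv : RegularVectorField v A K) (s t : ℝ) (x y : E) :
    ‖hv.invDeriv s t x - hv.invDeriv s t y‖ ≤
      K * ‖x - y‖ * |t - s| * Real.exp (3 * (K * |t - s|)) := by
  have hK := hv.nonneg
  set e := Real.exp (K * |t - s|) with he
  have hτ : ∀ τ ∈ uIcc s t, Real.exp (K * |τ - s|) ≤ e := fun τ hτ => by
    have := abs_sub_left_of_mem_uIcc hτ
    rw [he]
    gcongr
  have := norm_le_of_norm_deriv_le (s := s) (t := t) (ε := e * (K * (‖x - y‖ * e))) hK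
    (by positivity) (fun τ => (hv.hasDerivAt_invDeriv s τ x).sub (hv.hasDerivAt_invDeriv s τ y))
    (fun τ h => by
      have hsplit : -(hv.invDeriv s τ x ∘L A τ (hv.flow s τ x)) -
          -(hv.invDeriv s τ y ∘L A τ (hv.flow s τ y)) =
          -((hv.invDeriv s τ x - hv.invDeriv s τ y) ∘L A τ (hv.flow s τ x)) -
            hv.invDeriv s τ y ∘L (A τ (hv.flow s τ x) - A τ (hv.flow s τ y)) := by
        rw [ContinuousLinearMap.sub_comp, ContinuousLinearMap.comp_sub]; abel
      rw [hsplit]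
      refine (norm_sub_le _ _).trans (add_le_add ?_ ?_)
      · rw [norm_neg]
        exact hv.norm_comp_le _ _ _
      · refine (ContinuousLinearMap.opNorm_comp_le _ _).trans ?_
        gcongr
        · exact (hv.norm_invDeriv_le s τ y).trans (hτ τ h)
        · refine (hv.lipschitz_deriv _ _ _).trans ?_
          gcongr
          exact (hv.lipschitz_flow s τ x y).trans (by gcongr; exact hτ τ h))
  simp only [Pi.sub_apply, invDeriv_self, sub_self, norm_zero, zero_add] at this
  refine this.trans (le_of_eq ?_)
  have h3 : Real.exp (3 * (K * |t - s|)) = e * e * e := by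
    rw [he, ← Real.exp_add, ← Real.exp_add]; ring_nf
  rw [h3]
  ring

lemma continuous_invDeriv (hv : RegularVectorField v A K) (s : ℝ) :
    Continuous fun p : ℝ × E => hv.invDeriv s p.1 p.2 := by
  refine continuous_iff_continuousAt.2 fun ⟨t, x⟩ => ?_
  rw [ContinuousAt, tendsto_iff_norm_sub_tendsto_zero]
  have h1 : Continuous fun p : ℝ × E =>
      K * ‖p.2 - x‖ * |p.1 - s| * Real.exp (3 * (K * |p.1 - s|)) +
        ‖hv.invDeriv s p.1 x - hv.invDeriv s t x‖ := by
    have : Continuous fun t => hv.invDeriv s t x :=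
      continuous_iff_continuousAt.2 fun t => (hv.hasDerivAt_invDeriv s t x).continuousAt
    have := this.comp (continuous_fst : Continuous (Prod.fst : ℝ × E → ℝ))
    simp only [Function.comp_def] at this
    fun_prop
  refine squeeze_zero (fun _ => norm_nonneg _) (fun p => ?_) (by simpa using h1.tendsto (t, x))
  calc _ = ‖(hv.invDeriv s p.1 p.2 - hv.invDeriv s p.1 x) +
        (hv.invDeriv s p.1 x - hv.invDeriv s t x)‖ := by rw [sub_add_sub_cancel]
    _ ≤ _ := (norm_add_le _ _).trans (add_le_add_left (hv.norm_invDeriv_sub_le s p.1 p.2 x) _)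

lemma continuous_invDeriv_right (hv : RegularVectorField v A K) (s t : ℝ) :
    Continuous (hv.invDeriv s t) := by
  have h := (hv.continuous_invDeriv s).comp (Continuous.prodMk_right t)
  simpa only [Function.comp_def] using h

/-- The flow is differentiable in space. The solution `J` of the linearized equation that equals
`id` at time `t` is the derivative of `flow t s` at time `s`, because `flow t · x + J · h` solves
the equation up to `O(‖h‖²)`; and `invDeriv s · ∘ J` is constant in time. -/
lemma hasFDerivAt_flow (hv : RegularVectorField v A K) (s t : ℝ) (x : E) :
    HasFDerivAt (hv.flow t s) (hv.invDeriv s t x) (hv.flow s t x) := by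
  have hK := hv.nonneg
  obtain ⟨J, hJt, hJ⟩ : ∃ J : ℝ → E →L[ℝ] E, J t = ContinuousLinearMap.id ℝ E ∧
      ∀ τ, HasDerivAt J (A τ (hv.flow s τ x) ∘L J τ) τ := by
    refine exists_global_solution (f := fun t m => A t (hv.flow s t x) ∘L m) (K := K) (C := K)
      ?_ hv.nonneg ?_ t (ContinuousLinearMap.id ℝ E) ?_
    · exact ((hv.continuous_along (hv.continuous_flow_mid s x)).comp continuous_fst).clm_comp
        continuous_snd
    · intro t m m'
      rw [← ContinuousLinearMap.comp_sub]
      exact (ContinuousLinearMap.opNorm_comp_le _ _).trans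
        (mul_le_mul_of_nonneg_right (hv.norm_deriv_le _ _) (norm_nonneg _))
    · intro t
      rw [ContinuousLinearMap.comp_id]
      exact hv.norm_deriv_le _ _
  have hMJ : hv.invDeriv s t x = J s := by
    have hd : ∀ τ, HasDerivAt (fun τ => hv.invDeriv s τ x ∘L J τ) 0 τ := fun τ => by
      convert (hv.hasDerivAt_invDeriv s τ x).clm_comp (hJ τ) using 1
      rw [ContinuousLinearMap.neg_comp, ContinuousLinearMap.comp_assoc]
      abel
    have := is_const_of_deriv_eq_zero (fun τ => (hd τ).differentiableAt) (fun τ => (hd τ).deriv) t s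
    simpa [hJt, invDeriv_self] using this
  rw [hMJ, hasFDerivAt_iff_isLittleO_nhds_zero]
  refine Asymptotics.IsBigO.trans_isLittleO (g := fun h : E => ‖h‖ ^ 2) ?_
    (Asymptotics.isLittleO_norm_pow_id one_lt_two)
  set e := Real.exp (K * |s - t|) with he
  refine Asymptotics.IsBigO.of_bound (K * e ^ 2 * |s - t| * e) (Eventually.of_forall fun h => ?_)
  have hτ : ∀ τ ∈ uIcc t s, Real.exp (K * |τ - t|) ≤ e := fun τ hτ => by
    have := abs_sub_left_of_mem_uIcc hτ
    rw [he]
    gcongr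
  set y := hv.flow s t x with hy
  have hX : ∀ τ, hv.flow t τ y = hv.flow s τ x := fun τ => hv.flow_flow s t τ x
  have := norm_le_of_norm_deriv_le (s := t) (t := s) (ε := K * (‖h‖ * e) ^ 2) hK (by positivity)
    (fun τ => ((hv.hasDerivAt_flow t τ (y + h)).sub (hv.hasDerivAt_flow t τ y)).sub
      ((hJ τ).clm_apply (hasDerivAt_const τ h)))
    (fun τ hm => by
      have hle : ‖hv.flow t τ (y + h) - hv.flow t τ y‖ ≤ ‖h‖ * e := by
        refine (hv.lipschitz_flow t τ (y + h) y).trans ?_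
        rw [add_sub_cancel_left]
        gcongr
        exact hτ τ hm
      have h1 := hv.norm_sub_sub_le τ (hv.flow t τ y) (hv.flow t τ (y + h))
      have h2 : ‖A τ (hv.flow t τ y) (hv.flow t τ (y + h) - hv.flow t τ y - J τ h)‖ ≤
          K * ‖hv.flow t τ (y + h) - hv.flow t τ y - J τ h‖ :=
        (A τ (hv.flow t τ y)).le_of_opNorm_le (hv.norm_deriv_le _ _) _
      have h3 : K * ‖hv.flow t τ (y + h) - hv.flow t τ y‖ ^ 2 ≤ K * (‖h‖ * e) ^ 2 := by gcongr
      have hsplit : v τ (hv.flow t τ (y + h)) - v τ (hv.flow t τ y) -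
          ((A τ (hv.flow s τ x) ∘L J τ) h + J τ 0) =
          A τ (hv.flow t τ y) (hv.flow t τ (y + h) - hv.flow t τ y - J τ h) +
          (v τ (hv.flow t τ (y + h)) - v τ (hv.flow t τ y) -
            A τ (hv.flow t τ y) (hv.flow t τ (y + h) - hv.flow t τ y)) := by
        rw [← hX τ]
        simp only [map_sub, ContinuousLinearMap.comp_apply, map_zero]
        abel
      rw [hsplit]
      exact (norm_add_le _ _).trans (add_le_add h2 (h1.trans h3)))
  simp only [Pi.sub_apply, flow_self, hJt, add_sub_cancel_left, ContinuousLinearMap.id_apply,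
    sub_self, norm_zero, zero_add] at this
  rw [norm_pow, norm_norm]
  refine this.trans (le_of_eq ?_)
  ring

lemma hasFDerivAt_flow_left_self (hv : RegularVectorField v A K) (t : ℝ) (x : E) :
    HasFDerivAt (fun p : ℝ × E => hv.flow p.1 t p.2)
      (ContinuousLinearMap.snd ℝ ℝ E - (ContinuousLinearMap.fst ℝ ℝ E).smulRight (v t x))
      (t, x) := by
  rw [hasFDerivAt_iff_isLittleO, Asymptotics.isLittleO_iff]
  intro c hc
  obtain ⟨δ, hδ, hvδ⟩ := Metric.continuousAt_iff.1
    (hv.continuous.continuousAt (x := (t, x))) c hc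
  have hK := hv.nonneg
  have hr : 0 < δ / (K + 2) := by positivity
  filter_upwards [Metric.ball_mem_nhds (t, x) hr] with p hp
  rw [Metric.mem_ball, Prod.dist_eq, max_lt_iff, Real.dist_eq, dist_eq_norm] at hp
  simp only at hp
  have hderiv : ∀ τ, HasDerivAt (fun τ => hv.flow p.1 τ p.2 - τ • v t x)
      (v τ (hv.flow p.1 τ p.2) - (1 : ℝ) • v t x) τ := fun τ =>
    (hv.hasDerivAt_flow p.1 τ p.2).sub ((hasDerivAt_id τ).smul_const _)
  have hmain := (convex_uIcc p.1 t).norm_image_sub_le_of_norm_hasDerivWithin_le (C := c)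
    (fun τ _ => (hderiv τ).hasDerivWithinAt) (fun τ hτ => by
      rw [one_smul, ← dist_eq_norm]
      refine (hvδ (x := (τ, hv.flow p.1 τ p.2)) ?_).le
      have h1 : |τ - t| ≤ |p.1 - t| := by
        rw [abs_sub_comm, abs_sub_comm p.1]
        exact abs_sub_right_of_mem_uIcc hτ
      have h2 : |τ - p.1| ≤ |p.1 - t| := by
        rw [abs_sub_comm p.1]
        exact abs_sub_left_of_mem_uIcc hτ
      have h3 := hv.norm_flow_sub_le p.1 τ p.2
      have h4 : K * |τ - p.1| ≤ K * (δ / (K + 2)) := by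
        have := h2.trans hp.1.le
        gcongr
      have h5 : ‖hv.flow p.1 τ p.2 - x‖ ≤ ‖hv.flow p.1 τ p.2 - p.2‖ + ‖p.2 - x‖ := by
        rw [← sub_add_sub_cancel _ p.2 x]
        exact norm_add_le _ _
      have h6 : (K + 2) * (δ / (K + 2)) = δ := by field_simp
      rw [Prod.dist_eq, max_lt_iff, Real.dist_eq, dist_eq_norm]
      simp only
      constructor <;> nlinarith [hp.1, hp.2]) left_mem_uIcc right_mem_uIcc
  have hle : ‖t - p.1‖ ≤ ‖p - (t, x)‖ := by
    rw [norm_sub_rev]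
    exact norm_fst_le (p - (t, x))
  have heq : hv.flow p.1 t p.2 - hv.flow t t x - (ContinuousLinearMap.snd ℝ ℝ E -
      (ContinuousLinearMap.fst ℝ ℝ E).smulRight (v t x)) (p - (t, x)) =
      hv.flow p.1 t p.2 - t • v t x - (hv.flow p.1 p.1 p.2 - p.1 • v t x) := by
    simp [sub_smul]
    abel
  rw [heq]
  exact hmain.trans (by gcongr)

/-- The map `(t, x) ↦ flow t s x` is differentiable, and its derivative vanishes in the direction
`(1, v t x)`. -/
lemma hasFDerivAt_flow_left (hv : RegularVectorField v A K) (s t : ℝ) (x : E) :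
    HasFDerivAt (fun p : ℝ × E => hv.flow p.1 s p.2)
      (hv.invDeriv s t (hv.flow t s x) ∘L
        (ContinuousLinearMap.snd ℝ ℝ E - (ContinuousLinearMap.fst ℝ ℝ E).smulRight (v t x)))
      (t, x) := by
  have h := hv.hasFDerivAt_flow s t (hv.flow t s x)
  rw [flow_flow, flow_self] at h
  have h' : HasFDerivAt (hv.flow t s) (hv.invDeriv s t (hv.flow t s x)) (hv.flow t t x) := by
    rwa [flow_self]
  have := HasFDerivAt.comp (t, x) h' (hv.hasFDerivAt_flow_left_self t x)
  refine this.congr_of_eventuallyEq (Eventually.of_forall fun p => ?_)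
  exact (hv.flow_flow p.1 t s p.2).symm

lemma contDiff_flow_left (hv : RegularVectorField v A K) (s : ℝ) :
    ContDiff ℝ 1 fun p : ℝ × E => hv.flow p.1 s p.2 := by
  refine contDiff_one_iff_hasFDerivAt.2 ⟨_, ?_, fun p => hv.hasFDerivAt_flow_left s p.1 p.2⟩
  have h1 : Continuous fun p : ℝ × E => hv.flow p.1 s p.2 :=
    continuous_iff_continuousAt.2 fun p => (hv.hasFDerivAt_flow_left s p.1 p.2).continuousAt
  have h2 := (hv.continuous_invDeriv s).comp (continuous_fst.prodMk h1)
  refine h2.clm_comp (continuous_const.sub ?_)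
  exact (ContinuousLinearMap.smulRightL ℝ (ℝ × E) E
    (ContinuousLinearMap.fst ℝ ℝ E)).continuous.comp hv.continuous

variable {v₁ v₂ : ℝ → E → E} {A₁ A₂ : ℝ → E → E →L[ℝ] E}

/-- Uniqueness for fields that depend on their own flow: if at each time the difference of two
fields is controlled by the difference of their flows and of the inverse derivatives of these, then
the flows agree. The distances, measured with the weight `e^{-m (t - t₀)}` for a large `m`, are
at most half of themselves. -/
theorem flow_eq_of_closed_loop (h₁ : RegularVectorField v₁ A₁ K) (h₂ : RegularVectorField v₂ A₂ K)
    {t₀ T H : ℝ} (hH : 0 ≤ H)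
    (hclosed : ∀ t ∈ Icc t₀ T, ∀ S : ℝ, (∀ x, ‖h₁.flow t₀ t x - h₂.flow t₀ t x‖ ≤ S ∧
      ‖h₁.invDeriv t₀ t x - h₂.invDeriv t₀ t x‖ ≤ S) →
      ∀ x, ‖v₁ t x - v₂ t x‖ ≤ H * S ∧ ‖A₁ t x - A₂ t x‖ ≤ H * S) :
    ∀ t ∈ Icc t₀ T, ∀ x, h₁.flow t₀ t x = h₂.flow t₀ t x ∧
      h₁.invDeriv t₀ t x = h₂.invDeriv t₀ t x := by
  rcases lt_or_ge T t₀ with hT | hT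
  · intro t ht
    exact absurd (ht.1.trans ht.2) (not_le.2 hT)
  have hK := h₁.nonneg
  set R := Real.exp (K * (T - t₀)) with hR
  have hM : ∀ {v : ℝ → E → E} {A : ℝ → E → E →L[ℝ] E} (h : RegularVectorField v A K),
      ∀ t ∈ Icc t₀ T, ∀ x, ‖h.invDeriv t₀ t x‖ ≤ R := by
    intro v A h t ht x
    refine (h.norm_invDeriv_le t₀ t x).trans ?_
    rw [abs_of_nonneg (sub_nonneg.2 ht.1)]
    exact Real.exp_le_exp.2 (by gcongr; exact ht.2)
  have hR0 : 0 ≤ R := (Real.exp_pos _).le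
  -- `m` is twice the Lipschitz constant of the closed system, so that one use of the integral
  -- equations halves a bound of the form `S * exp (m * (t - t₀))`.
  set m := 2 * (K + H + R * K + R * H) with hm
  have hm0 : 0 ≤ m := by positivity
  set S₀ := 2 * (K * (T - t₀)) + 2 * R with hS₀
  have hS₀0 : 0 ≤ S₀ := by
    have := mul_nonneg hK (sub_nonneg.2 hT)
    positivity
  have hiter : ∀ n : ℕ, ∀ t ∈ Icc t₀ T, ∀ x,
      ‖h₁.flow t₀ t x - h₂.flow t₀ t x‖ ≤ (1 / 2) ^ n * S₀ * Real.exp (m * (t - t₀)) ∧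
      ‖h₁.invDeriv t₀ t x - h₂.invDeriv t₀ t x‖ ≤
        (1 / 2) ^ n * S₀ * Real.exp (m * (t - t₀)) := by
    intro n
    induction n with
    | zero =>
      intro t ht x
      have he : 1 ≤ Real.exp (m * (t - t₀)) :=
        Real.one_le_exp (mul_nonneg hm0 (sub_nonneg.2 ht.1))
      have hS : S₀ ≤ (1 / 2) ^ 0 * S₀ * Real.exp (m * (t - t₀)) := by
        rw [pow_zero, one_mul]
        exact le_mul_of_one_le_right hS₀0 he
      have hKt : K * |t - t₀| ≤ K * (T - t₀) := by
        rw [abs_of_nonneg (sub_nonneg.2 ht.1)]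
        gcongr
        exact ht.2
      constructor
      · have e1 := (h₁.norm_flow_sub_le t₀ t x).trans hKt
        have e2 := (h₂.norm_flow_sub_le t₀ t x).trans hKt
        have e3 := norm_sub_le (h₁.flow t₀ t x - x) (h₂.flow t₀ t x - x)
        rw [sub_sub_sub_cancel_right] at e3
        linarith
      · have e1 := hM h₁ t ht x
        have e2 := hM h₂ t ht x
        have e3 := norm_sub_le (h₁.invDeriv t₀ t x) (h₂.invDeriv t₀ t x)
        have := mul_nonneg hK (sub_nonneg.2 hT)
        linarith
    | succ n ih =>
      set S := (1 / 2) ^ n * S₀ with hS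
      have hS0 : 0 ≤ S := by positivity
      have hB : ∀ t, HasDerivAt (fun t => S / 2 * Real.exp (m * (t - t₀)))
          (S / 2 * (Real.exp (m * (t - t₀)) * (m * 1))) t := fun t =>
        ((((hasDerivAt_id t).sub_const t₀).const_mul m).exp).const_mul _
      have hBS : ∀ t, (1 / 2) ^ (n + 1) * S₀ * Real.exp (m * (t - t₀)) =
          S / 2 * Real.exp (m * (t - t₀)) := fun t => by
        rw [hS, pow_succ]; ring
      have hmS : ∀ t, S / 2 * (Real.exp (m * (t - t₀)) * (m * 1)) =
          (K + H + R * K + R * H) * (S * Real.exp (m * (t - t₀))) := fun t => by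
        rw [hm]; ring
      intro t ht x
      rw [hBS]
      constructor
      · refine image_norm_le_of_norm_deriv_right_le_deriv_boundary
          (f := fun t => h₁.flow t₀ t x - h₂.flow t₀ t x)
          (fun t _ => ((h₁.hasDerivAt_flow t₀ t x).sub
            (h₂.hasDerivAt_flow t₀ t x)).continuousAt.continuousWithinAt)
          (fun t _ => ((h₁.hasDerivAt_flow t₀ t x).sub
            (h₂.hasDerivAt_flow t₀ t x)).hasDerivWithinAt) ?_ hB ?_ ht
        · simp only [flow_self, sub_self, norm_zero]
          positivity
        · intro t ht
          have ht' : t ∈ Icc t₀ T := ⟨ht.1, ht.2.le⟩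
          have hc := (hclosed t ht' _ (ih t ht') (h₂.flow t₀ t x)).1
          have hx := (ih t ht' x).1
          set e := S * Real.exp (m * (t - t₀))
          have he0 : 0 ≤ e := by positivity
          rw [hmS]
          calc _ = ‖(v₁ t (h₁.flow t₀ t x) - v₁ t (h₂.flow t₀ t x)) +
                (v₁ t (h₂.flow t₀ t x) - v₂ t (h₂.flow t₀ t x))‖ := by rw [sub_add_sub_cancel]
            _ ≤ K * e + H * e := (norm_add_le _ _).trans
                (add_le_add ((h₁.lipschitz _ _ _).trans (by gcongr)) hc)
            _ ≤ _ := by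
                have : 0 ≤ (R * K + R * H) * e := by positivity
                linarith
      · refine image_norm_le_of_norm_deriv_right_le_deriv_boundary
          (f := fun t => h₁.invDeriv t₀ t x - h₂.invDeriv t₀ t x)
          (fun t _ => ((h₁.hasDerivAt_invDeriv t₀ t x).sub
            (h₂.hasDerivAt_invDeriv t₀ t x)).continuousAt.continuousWithinAt)
          (fun t _ => ((h₁.hasDerivAt_invDeriv t₀ t x).sub
            (h₂.hasDerivAt_invDeriv t₀ t x)).hasDerivWithinAt) ?_ hB ?_ ht
        · simp only [invDeriv_self, sub_self, norm_zero]
          positivity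
        · intro t ht
          have ht' : t ∈ Icc t₀ T := ⟨ht.1, ht.2.le⟩
          have hc := (hclosed t ht' _ (ih t ht') (h₂.flow t₀ t x)).2
          have hx := (ih t ht' x).1
          have hy := (ih t ht' x).2
          have hM₂ := hM h₂ t ht' x
          set e := S * Real.exp (m * (t - t₀))
          have he0 : 0 ≤ e := by positivity
          rw [hmS]
          set X₁ := h₁.flow t₀ t x
          set X₂ := h₂.flow t₀ t x
          set M₁ := h₁.invDeriv t₀ t x
          set M₂ := h₂.invDeriv t₀ t x
          have hsplit : -(M₁ ∘L A₁ t X₁) - -(M₂ ∘L A₂ t X₂) = -((M₁ - M₂) ∘L A₁ t X₁) -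
              M₂ ∘L ((A₁ t X₁ - A₁ t X₂) + (A₁ t X₂ - A₂ t X₂)) := by
            rw [sub_add_sub_cancel, ContinuousLinearMap.sub_comp, ContinuousLinearMap.comp_sub]
            abel
          rw [hsplit]
          have e1 : ‖(M₁ - M₂) ∘L A₁ t X₁‖ ≤ K * e :=
            (h₁.norm_comp_le _ _ _).trans (by gcongr)
          have e2 : ‖M₂ ∘L ((A₁ t X₁ - A₁ t X₂) + (A₁ t X₂ - A₂ t X₂))‖ ≤ R * (K * e + H * e) := by
            refine (ContinuousLinearMap.opNorm_comp_le _ _).trans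
              (mul_le_mul hM₂ ?_ (norm_nonneg _) hR0)
            exact (norm_add_le _ _).trans
              (add_le_add ((h₁.lipschitz_deriv _ _ _).trans (by gcongr)) hc)
          have e3 := norm_sub_le (-((M₁ - M₂) ∘L A₁ t X₁))
            (M₂ ∘L ((A₁ t X₁ - A₁ t X₂) + (A₁ t X₂ - A₂ t X₂)))
          rw [norm_neg] at e3
          have : 0 ≤ H * e := by positivity
          linarith
  intro t ht x
  have hlim : Tendsto (fun n : ℕ => (1 / 2 : ℝ) ^ n * S₀ * Real.exp (m * (t - t₀))) atTop
      (𝓝 0) := by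
    have := ((tendsto_pow_atTop_nhds_zero_of_lt_one (r := (1 / 2 : ℝ)) (by norm_num)
      (by norm_num)).mul_const S₀).mul_const (Real.exp (m * (t - t₀)))
    simpa using this
  exact ⟨sub_eq_zero.1 (norm_le_zero_iff.1 (ge_of_tendsto' hlim fun n => (hiter n t ht x).1)),
    sub_eq_zero.1 (norm_le_zero_iff.1 (ge_of_tendsto' hlim fun n => (hiter n t ht x).2))⟩

end RegularVectorField

end ODE

variable {d₁ d₂ d' : ℕ}

/-! ### The continuity equation -/

lemma inner_gradX {φ : Eu d₁ × Eu d₂ → ℝ} {p : Eu d₁ × Eu d₂} (hφ : DifferentiableAt ℝ φ p)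
    (w : Eu d₁) : inner ℝ w (gradX φ p) = fderiv ℝ φ p (w, 0) := by
  have h : HasFDerivAt (fun x => φ (x, p.2))
      ((fderiv ℝ φ p).comp (ContinuousLinearMap.inl ℝ (Eu d₁) (Eu d₂))) p.1 :=
    HasFDerivAt.comp p.1 (f := fun x => (x, p.2)) (by simpa using hφ.hasFDerivAt)
      (hasFDerivAt_prodMk_left p.1 p.2)
  rw [gradX, gradient, h.fderiv, real_inner_comm, InnerProductSpace.toDual_symm_apply]
  rfl

lemma measurable_flow_prodMap {v : ℝ → Eu d₁ → Eu d₁} {A : ℝ → Eu d₁ → Eu d₁ →L[ℝ] Eu d₁} {K : ℝ}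
    (hv : RegularVectorField v A K) (s t : ℝ) :
    Measurable fun p : Eu d₁ × Eu d₂ => (hv.flow s t p.1, p.2) :=
  (((hv.continuous_flow_right s t).comp continuous_fst).prodMk continuous_snd).measurable

/-- Test functions that are constant along the characteristics have a constant integral. The
time cutoff `χ` only serves to make the test function and its derivatives bounded. -/
lemma SolvesContinuity.integral_comp_flow {b : Eu d₁ → Eu d' → Eu d₁} {t₀ T : ℝ}
    {γ₀ : ProbabilityMeasure (Eu d₁ × Eu d₂)} {ν : ℝ → ProbabilityMeasure (Eu d')}
    {γ : ℝ → ProbabilityMeasure (Eu d₁ × Eu d₂)} (h : SolvesContinuity b t₀ T γ₀ ν γ)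
    {v : ℝ → Eu d₁ → Eu d₁} {A : ℝ → Eu d₁ → Eu d₁ →L[ℝ] Eu d₁} {K : ℝ}
    (hv : RegularVectorField v A K) (hvν : ∀ t ∈ Icc t₀ T, ∀ x, v t x = avg b x (ν t))
    {t₁ : ℝ} (ht₁ : t₁ ∈ Icc t₀ T) (Λ : StrongDual ℝ (Eu d₁ × Eu d₂)) {c c' : ℝ → ℝ}
    (hc : ContDiff ℝ 1 c) (hcc' : ∀ r, HasDerivAt c (c' r) r) (hc1 : ∀ r, |c r| ≤ 1)
    (hc'1 : ∀ r, |c' r| ≤ 1) :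
    ∫ p, c (Λ (hv.flow t₁ t₀ p.1, p.2)) ∂(γ t₁ : Measure (Eu d₁ × Eu d₂)) =
      ∫ p, c (Λ p) ∂(γ₀ : Measure (Eu d₁ × Eu d₂)) := by
  have hK := hv.nonneg
  have h0T : 0 ≤ T - t₀ := by linarith [ht₁.1, ht₁.2]
  let χ : ContDiffBump t₀ := ⟨T - t₀ + 1, T - t₀ + 2, by linarith, by linarith⟩
  have hχ1 : ∀ t ∈ Icc t₀ T, χ =ᶠ[𝓝 t] 1 := fun t ht =>
    χ.eventuallyEq_one_of_mem_ball (by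
      rw [Metric.mem_ball, Real.dist_eq, abs_of_nonneg (by linarith [ht.1])]
      change t - t₀ < T - t₀ + 1
      linarith [ht.2])
  have hχd : ∀ t, HasDerivAt χ (deriv χ t) t := fun t =>
    ((χ.contDiff (n := 1)).differentiable one_ne_zero t).hasDerivAt
  obtain ⟨B, hB⟩ : ∃ B, ∀ t, ‖deriv χ t‖ ≤ B :=
    χ.hasCompactSupport.deriv.exists_bound_of_continuous
      ((χ.contDiff (n := 1)).continuous_deriv le_rfl)
  have hB0 : 0 ≤ B := (norm_nonneg _).trans (hB 0)
  let D : ℝ × Eu d₁ × Eu d₂ → (ℝ × Eu d₁ × Eu d₂) →L[ℝ] Eu d₁ × Eu d₂ := fun q =>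
    ((hv.invDeriv t₀ q.1 (hv.flow q.1 t₀ q.2.1) ∘L
      (ContinuousLinearMap.snd ℝ ℝ (Eu d₁) -
        (ContinuousLinearMap.fst ℝ ℝ (Eu d₁)).smulRight (v q.1 q.2.1))) ∘L
      ((ContinuousLinearMap.fst ℝ ℝ (Eu d₁ × Eu d₂)).prod
        (ContinuousLinearMap.fst ℝ (Eu d₁) (Eu d₂) ∘L
          ContinuousLinearMap.snd ℝ ℝ (Eu d₁ × Eu d₂)))).prod
    (ContinuousLinearMap.snd ℝ (Eu d₁) (Eu d₂) ∘L ContinuousLinearMap.snd ℝ ℝ (Eu d₁ × Eu d₂))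
  let Q : ℝ × Eu d₁ × Eu d₂ → Eu d₁ × Eu d₂ := fun q => (hv.flow q.1 t₀ q.2.1, q.2.2)
  have hDapp : ∀ q w, D q w = (hv.invDeriv t₀ q.1 (hv.flow q.1 t₀ q.2.1)
      (w.2.1 - w.1 • v q.1 q.2.1), w.2.2) := fun q w => rfl
  have hQD : ∀ q, HasFDerivAt Q (D q) q := by
    intro q
    have h1 : HasFDerivAt (fun q : ℝ × Eu d₁ × Eu d₂ => (q.1, q.2.1))
        ((ContinuousLinearMap.fst ℝ ℝ (Eu d₁ × Eu d₂)).prod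
        (ContinuousLinearMap.fst ℝ (Eu d₁) (Eu d₂) ∘L
          ContinuousLinearMap.snd ℝ ℝ (Eu d₁ × Eu d₂))) q :=
      ((ContinuousLinearMap.fst ℝ ℝ (Eu d₁ × Eu d₂)).prod
        (ContinuousLinearMap.fst ℝ (Eu d₁) (Eu d₂) ∘L
          ContinuousLinearMap.snd ℝ ℝ (Eu d₁ × Eu d₂))).hasFDerivAt
    have h2 := HasFDerivAt.comp q (f := fun q : ℝ × Eu d₁ × Eu d₂ => (q.1, q.2.1))
      (hv.hasFDerivAt_flow_left t₀ q.1 q.2.1) h1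
    exact h2.prodMk (ContinuousLinearMap.hasFDerivAt (ContinuousLinearMap.snd ℝ (Eu d₁) (Eu d₂) ∘L
      ContinuousLinearMap.snd ℝ ℝ (Eu d₁ × Eu d₂)))
  have hQC : ContDiff ℝ 1 Q :=
    ((hv.contDiff_flow_left t₀).comp (contDiff_fst.prodMk (contDiff_fst.comp contDiff_snd))).prodMk
      (contDiff_snd.comp contDiff_snd)
  let φ : ℝ × Eu d₁ × Eu d₂ → ℝ := fun q => χ q.1 * c (Λ (Q q))
  have hφC : ContDiff ℝ 1 φ :=
    (χ.contDiff.comp contDiff_fst).mul (hc.comp (Λ.contDiff.comp hQC))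
  let Dφ : ℝ × Eu d₁ × Eu d₂ → (ℝ × Eu d₁ × Eu d₂) →L[ℝ] ℝ := fun q =>
    χ q.1 • (c' (Λ (Q q)) • (Λ ∘L D q)) +
      c (Λ (Q q)) • (deriv χ q.1 • ContinuousLinearMap.fst ℝ ℝ (Eu d₁ × Eu d₂))
  have hφD : ∀ q, HasFDerivAt φ (Dφ q) q := by
    intro q
    have h1 : HasFDerivAt (fun q : ℝ × Eu d₁ × Eu d₂ => χ q.1)
        (deriv χ q.1 • ContinuousLinearMap.fst ℝ ℝ (Eu d₁ × Eu d₂)) q :=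
      (hχd q.1).comp_hasFDerivAt q (ContinuousLinearMap.hasFDerivAt
        (ContinuousLinearMap.fst ℝ ℝ (Eu d₁ × Eu d₂)))
    have h2 : HasFDerivAt (fun q => c (Λ (Q q))) (c' (Λ (Q q)) • (Λ ∘L D q)) q :=
      (hcc' _).comp_hasFDerivAt q (HasFDerivAt.comp q Λ.hasFDerivAt (hQD q))
    exact h1.mul h2
  set R := Real.exp (K * (T - t₀ + 2)) * (1 + K) + 1 with hR
  have hDn : ∀ q : ℝ × Eu d₁ × Eu d₂, |q.1 - t₀| ≤ T - t₀ + 2 → ‖D q‖ ≤ R := by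
    intro q hq
    refine ContinuousLinearMap.opNorm_le_bound _ (by positivity) fun w => ?_
    rw [hDapp, Prod.norm_def, max_le_iff]
    have hw1 : ‖w.1‖ ≤ ‖w‖ := norm_fst_le w
    have hw2 : ‖w.2.1‖ ≤ ‖w‖ := (norm_fst_le w.2).trans (norm_snd_le w)
    have hw3 : ‖w.2.2‖ ≤ ‖w‖ := (norm_snd_le w.2).trans (norm_snd_le w)
    have hM : ‖hv.invDeriv t₀ q.1 (hv.flow q.1 t₀ q.2.1)‖ ≤ Real.exp (K * (T - t₀ + 2)) :=
      (hv.norm_invDeriv_le _ _ _).trans (by gcongr)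
    constructor
    · calc _ ≤ Real.exp (K * (T - t₀ + 2)) * ‖w.2.1 - w.1 • v q.1 q.2.1‖ :=
            ContinuousLinearMap.le_of_opNorm_le _ hM _
        _ ≤ Real.exp (K * (T - t₀ + 2)) * (‖w‖ + ‖w‖ * K) := by
            gcongr
            refine (norm_sub_le _ _).trans (add_le_add hw2 ?_)
            rw [norm_smul]
            exact mul_le_mul hw1 (hv.norm_le _ _) (norm_nonneg _) (norm_nonneg _)
        _ = Real.exp (K * (T - t₀ + 2)) * (1 + K) * ‖w‖ := by ring
        _ ≤ R * ‖w‖ := by rw [hR]; gcongr; linarith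
    · refine hw3.trans (le_mul_of_one_le_left (norm_nonneg _) ?_)
      rw [hR]
      have : 0 ≤ Real.exp (K * (T - t₀ + 2)) * (1 + K) := by positivity
      linarith
  have htest : TestFunction φ := by
    refine ⟨hφC, 1 + ‖Λ‖ * R + B, fun q => ⟨?_, ?_⟩⟩
    · have h1 : |φ q| ≤ 1 := by
        change |χ q.1 * c (Λ (Q q))| ≤ 1
        rw [abs_mul, abs_of_nonneg χ.nonneg]
        exact mul_le_one₀ χ.le_one (abs_nonneg _) (hc1 _)
      have : 0 ≤ ‖Λ‖ * R + B := by positivity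
      linarith
    · rw [(hφD q).fderiv]
      have h1 : ‖χ q.1 • (c' (Λ (Q q)) • (Λ ∘L D q))‖ ≤ ‖Λ‖ * R := by
        by_cases hq : |q.1 - t₀| ≤ T - t₀ + 2
        · rw [norm_smul, norm_smul, Real.norm_of_nonneg χ.nonneg, Real.norm_eq_abs]
          have h2 : ‖Λ ∘L D q‖ ≤ ‖Λ‖ * R :=
            (ContinuousLinearMap.opNorm_comp_le _ _).trans (by gcongr; exact hDn q hq)
          calc χ q.1 * (|c' (Λ (Q q))| * ‖Λ ∘L D q‖) ≤ 1 * (1 * (‖Λ‖ * R)) :=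
                mul_le_mul χ.le_one (mul_le_mul (hc'1 _) h2 (norm_nonneg _) zero_le_one)
                  (by positivity) zero_le_one
            _ = _ := by ring
        · have : χ q.1 = 0 := χ.zero_of_le_dist (by
            rw [Real.dist_eq]; exact (not_le.1 hq).le)
          rw [this, zero_smul, norm_zero]
          positivity
      have h2 : ‖c (Λ (Q q)) • (deriv χ q.1 • ContinuousLinearMap.fst ℝ ℝ (Eu d₁ × Eu d₂))‖ ≤
          B := by
        rw [norm_smul, norm_smul, Real.norm_eq_abs]
        calc _ ≤ 1 * (B * 1) := mul_le_mul (hc1 _) (mul_le_mul (hB _)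
                (ContinuousLinearMap.norm_fst_le _ _ _) (norm_nonneg _) hB0)
                (by positivity) zero_le_one
          _ = B := by ring
      have := norm_add_le (χ q.1 • (c' (Λ (Q q)) • (Λ ∘L D q)))
        (c (Λ (Q q)) • (deriv χ q.1 • ContinuousLinearMap.fst ℝ ℝ (Eu d₁ × Eu d₂)))
      change ‖χ q.1 • (c' (Λ (Q q)) • (Λ ∘L D q)) +
        c (Λ (Q q)) • (deriv χ q.1 • ContinuousLinearMap.fst ℝ ℝ (Eu d₁ × Eu d₂))‖ ≤ _
      linarith
  have hweak := h.weak φ htest t₁ ht₁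
  have hzero : ∀ t ∈ Icc t₀ T, ∀ p : Eu d₁ × Eu d₂, deriv (fun s => φ (s, p.1, p.2)) t +
      inner ℝ (avg b p.1 (ν t)) (gradX (fun q => φ (t, q.1, q.2)) p) = 0 := by
    intro t ht p
    have h0 : HasDerivAt (fun s : ℝ => (s, p)) (1, 0) t :=
      (hasDerivAt_id t).prodMk (hasDerivAt_const t p)
    have h1 : HasDerivAt (fun s => φ (s, p.1, p.2)) (Dφ (t, p.1, p.2) (1, 0)) t := by
      have := (hφD (t, p)).comp_hasDerivAt t h0
      exact this
    have h2 : HasFDerivAt (fun q : Eu d₁ × Eu d₂ => φ (t, q.1, q.2))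
        (Dφ (t, p.1, p.2) ∘L ContinuousLinearMap.inr ℝ ℝ (Eu d₁ × Eu d₂)) p :=
      HasFDerivAt.comp p (f := fun q : Eu d₁ × Eu d₂ => (t, q)) (hφD (t, p.1, p.2))
        (hasFDerivAt_prodMk_right t p)
    rw [h1.deriv, inner_gradX h2.differentiableAt, h2.fderiv, ContinuousLinearMap.comp_apply,
      ContinuousLinearMap.inr_apply, ← map_add, ← hvν t ht]
    have hd : deriv χ t = 0 := by
      rw [(hχ1 t ht).deriv_eq]
      exact deriv_const t 1
    change χ t * (c' (Λ (Q (t, p))) * Λ (D (t, p) _)) + c (Λ (Q (t, p))) * (deriv χ t * _) = 0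
    rw [hd, hDapp]
    simp only [zero_mul, mul_zero, add_zero, Prod.mk_add_mk, zero_add, one_smul, sub_self, map_zero]
    rw [Prod.mk_zero_zero, map_zero, mul_zero, mul_zero]
  have hint : ∫ t in t₀..t₁, ∫ p, (deriv (fun s => φ (s, p.1, p.2)) t +
          inner ℝ (avg b p.1 (ν t)) (gradX (fun q => φ (t, q.1, q.2)) p))
        ∂(γ t : Measure (Eu d₁ × Eu d₂)) = 0 := by
    rw [intervalIntegral.integral_congr (g := fun _ => (0 : ℝ))]
    · simp
    · intro t ht
      rw [uIcc_of_le ht₁.1] at ht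
      have : ∀ p : Eu d₁ × Eu d₂, deriv (fun s => φ (s, p.1, p.2)) t +
        inner ℝ (avg b p.1 (ν t)) (gradX (fun q => φ (t, q.1, q.2)) p) = 0 :=
        hzero t ⟨ht.1, ht.2.trans ht₁.2⟩
      simp only [this, integral_zero]
  rw [hint, add_zero] at hweak
  have e1 : ∀ t ∈ Icc t₀ T, ∀ p : Eu d₁ × Eu d₂, φ (t, p.1, p.2) =
      c (Λ (hv.flow t t₀ p.1, p.2)) := by
    intro t ht p
    change χ t * _ = _
    rw [(hχ1 t ht).eq_of_nhds, Pi.one_apply, one_mul]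
  simp only [e1 t₁ ht₁, e1 t₀ ⟨le_rfl, by linarith⟩, RegularVectorField.flow_self] at hweak
  exact hweak

/-- Uniqueness for the continuity equation: its solution is the image of the initial measure by the
flow. -/
theorem SolvesContinuity.eq_map_flow {b : Eu d₁ → Eu d' → Eu d₁} {t₀ T : ℝ}
    {γ₀ : ProbabilityMeasure (Eu d₁ × Eu d₂)} {ν : ℝ → ProbabilityMeasure (Eu d')}
    {γ : ℝ → ProbabilityMeasure (Eu d₁ × Eu d₂)} (h : SolvesContinuity b t₀ T γ₀ ν γ)
    {v : ℝ → Eu d₁ → Eu d₁} {A : ℝ → Eu d₁ → Eu d₁ →L[ℝ] Eu d₁} {K : ℝ}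
    (hv : RegularVectorField v A K) (hvν : ∀ t ∈ Icc t₀ T, ∀ x, v t x = avg b x (ν t))
    {t : ℝ} (ht : t ∈ Icc t₀ T) :
    (γ t : Measure (Eu d₁ × Eu d₂)) =
      (γ₀ : Measure (Eu d₁ × Eu d₂)).map fun p => (hv.flow t₀ t p.1, p.2) := by
  have hm := measurable_flow_prodMap (d₂ := d₂) hv t t₀
  have hm' := measurable_flow_prodMap (d₂ := d₂) hv t₀ t
  have key : (γ t : Measure (Eu d₁ × Eu d₂)).map (fun p => (hv.flow t t₀ p.1, p.2)) = γ₀ := by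
    have := Measure.isProbabilityMeasure_map (μ := (γ t : Measure (Eu d₁ × Eu d₂))) hm.aemeasurable
    refine Measure.ext_of_charFunDual (funext fun Λ => ?_)
    have hsplit : ∀ (μ : Measure (Eu d₁ × Eu d₂)) [IsProbabilityMeasure μ],
        charFunDual μ Λ = ((∫ p, Real.cos (Λ p) ∂μ : ℝ) : ℂ) +
          ((∫ p, Real.sin (Λ p) ∂μ : ℝ) : ℂ) * Complex.I := by
      intro μ _
      have hcos : Integrable (fun p => ((Real.cos (Λ p) : ℝ) : ℂ)) μ :=
        (Integrable.of_bound (Real.continuous_cos.comp Λ.continuous).aestronglyMeasurable 1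
          (ae_of_all _ fun p => Real.abs_cos_le_one _)).ofReal
      have hsin : Integrable (fun p => ((Real.sin (Λ p) : ℝ) : ℂ)) μ :=
        (Integrable.of_bound (Real.continuous_sin.comp Λ.continuous).aestronglyMeasurable 1
          (ae_of_all _ fun p => Real.abs_sin_le_one _)).ofReal
      rw [charFunDual_apply, ← integral_complex_ofReal, ← integral_complex_ofReal,
        ← integral_mul_const, ← integral_add hcos (hsin.mul_const _)]
      refine integral_congr_ae (ae_of_all _ fun p => ?_)
      simp only [Complex.exp_mul_I, Complex.ofReal_cos, Complex.ofReal_sin]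
    have hcos : Continuous fun p => Real.cos (Λ p) := Real.continuous_cos.comp Λ.continuous
    have hsin : Continuous fun p => Real.sin (Λ p) := Real.continuous_sin.comp Λ.continuous
    rw [hsplit, hsplit, integral_map hm.aemeasurable hcos.aestronglyMeasurable,
      integral_map hm.aemeasurable hsin.aestronglyMeasurable,
      h.integral_comp_flow hv hvν ht Λ Real.contDiff_cos Real.hasDerivAt_cos Real.abs_cos_le_one
        (fun r => by rw [abs_neg]; exact Real.abs_sin_le_one r),
      h.integral_comp_flow hv hvν ht Λ Real.contDiff_sin Real.hasDerivAt_sin Real.abs_sin_le_one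
        Real.abs_cos_le_one]
  rw [← key, Measure.map_map hm' hm]
  have : (fun p : Eu d₁ × Eu d₂ => (hv.flow t₀ t p.1, p.2)) ∘
      (fun p => (hv.flow t t₀ p.1, p.2)) = id := by
    funext p
    simp [RegularVectorField.flow_flow]
  rw [this, Measure.map_id]

/-! ### Continuity of integrals along curves in the Wasserstein space -/

/-- The easy half of the Kantorovich duality: integrals of `1`-Lipschitz functions differ by at most
the Wasserstein distance. -/
lemma enorm_integral_sub_le_wass₂ {μ μ' : ProbabilityMeasure (Eu d₁ × Eu d₂)}
    {h : Eu d₁ × Eu d₂ → ℝ} (hh : LipschitzWith 1 h) (hμ : Integrable h μ) (hμ' : Integrable h μ') :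
    ‖(∫ p, h p ∂(μ : Measure (Eu d₁ × Eu d₂))) - ∫ p, h p ∂(μ' : Measure (Eu d₁ × Eu d₂))‖ₑ ≤
      wass₂ μ μ' := by
  rw [wass₂, one_div, ENNReal.le_rpow_inv_iff (by norm_num)]
  refine le_iInf₂ fun π hπ => ?_
  have hprob : IsProbabilityMeasure π := by
    constructor
    rw [← preimage_univ (f := Prod.fst), ← Measure.map_apply measurable_fst MeasurableSet.univ,
      hπ.1, measure_univ]
  rw [← ENNReal.le_rpow_inv_iff (by norm_num)]
  have h1 : Integrable (fun q : (Eu d₁ × Eu d₂) × (Eu d₁ × Eu d₂) => h q.1) π := by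
    rw [← hπ.1] at hμ
    exact hμ.comp_measurable measurable_fst
  have h2 : Integrable (fun q : (Eu d₁ × Eu d₂) × (Eu d₁ × Eu d₂) => h q.2) π := by
    rw [← hπ.2] at hμ'
    exact hμ'.comp_measurable measurable_snd
  have hc := hh.continuous
  rw [← hπ.1, ← hπ.2, integral_map measurable_fst.aemeasurable hc.aestronglyMeasurable,
    integral_map measurable_snd.aemeasurable hc.aestronglyMeasurable, ← integral_sub h1 h2]
  refine (enorm_integral_le_lintegral_enorm _).trans ?_
  rw [← eLpNorm_one_eq_lintegral_enorm]
  refine (eLpNorm_le_eLpNorm_of_exponent_le (q := 2) (by norm_num)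
    (h1.sub h2).aestronglyMeasurable).trans ?_
  rw [eLpNorm_eq_lintegral_rpow_enorm_toReal (by norm_num) (by norm_num)]
  simp only [ENNReal.toReal_ofNat, one_div, ENNReal.rpow_ofNat]
  refine ENNReal.rpow_le_rpow (lintegral_mono fun q => ?_) (by norm_num)
  have h3 : ‖h q.1 - h q.2‖ₑ ≤ ‖q.1 - q.2‖ₑ := by
    have := hh q.1 q.2
    rwa [ENNReal.coe_one, one_mul, edist_eq_enorm_sub, edist_eq_enorm_sub] at this
  calc ‖h q.1 - h q.2‖ₑ ^ 2 ≤ ‖q.1 - q.2‖ₑ ^ 2 := by gcongr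
    _ ≤ _ := by
      have : ‖q.1 - q.2‖ₑ = max ‖q.1.1 - q.2.1‖ₑ ‖q.1.2 - q.2.2‖ₑ := rfl
      rw [this]
      rcases max_choice ‖q.1.1 - q.2.1‖ₑ ‖q.1.2 - q.2.2‖ₑ with h | h
      · rw [h]; exact le_self_add
      · rw [h]; exact le_add_self

lemma FiniteMoment.integrable_of_linear_growth {μ : ProbabilityMeasure (Eu d₁ × Eu d₂)} {r : ℝ≥0∞}
    (hr : 1 ≤ r) (hμ : FiniteMoment r μ) {F : Type*} [NormedAddCommGroup F]
    {h : Eu d₁ × Eu d₂ → F} (hc : AEStronglyMeasurable h (μ : Measure (Eu d₁ × Eu d₂))) {C : ℝ}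
    (hC : ∀ p, ‖h p‖ ≤ C * (1 + ‖p‖)) : Integrable h (μ : Measure (Eu d₁ × Eu d₂)) := by
  have h1 : Integrable (fun p : Eu d₁ × Eu d₂ => p) (μ : Measure (Eu d₁ × Eu d₂)) :=
    MemLp.integrable hr hμ
  exact Integrable.mono' (((integrable_const (1 : ℝ)).add h1.norm).const_mul C) hc (ae_of_all _ hC)

namespace ContinuousCurve

variable {t₀ T : ℝ} {γ : ℝ → ProbabilityMeasure (Eu d₁ × Eu d₂)}

lemma tendsto_integral_of_lipschitz (hγ : ContinuousCurve t₀ T γ) {s : ℝ} (hs : s ∈ Icc t₀ T)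
    {h : Eu d₁ × Eu d₂ → ℝ} {L : NNReal} (hh : LipschitzWith L h) :
    Tendsto (fun t => ∫ p, h p ∂(γ t : Measure (Eu d₁ × Eu d₂))) (𝓝[Icc t₀ T] s)
      (𝓝 (∫ p, h p ∂(γ s : Measure (Eu d₁ × Eu d₂)))) := by
  set l : ℝ := (L : ℝ) + 1 with hl
  have hl0 : 0 < l := by positivity
  set g : Eu d₁ × Eu d₂ → ℝ := fun p => l⁻¹ * h p with hg
  have hglip : LipschitzWith 1 g := LipschitzWith.of_dist_le_mul fun p q => by
    have := hh.dist_le_mul p q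
    rw [Real.dist_eq] at this ⊢
    rw [hg, ← mul_sub, abs_mul, abs_of_pos (inv_pos.2 hl0), inv_mul_le_iff₀ hl0, NNReal.coe_one,
      one_mul]
    refine this.trans ?_
    gcongr
    rw [hl]; linarith
  have hint : ∀ t ∈ Icc t₀ T, Integrable g (γ t : Measure (Eu d₁ × Eu d₂)) := fun t ht =>
    (hγ.moment t ht).integrable_of_linear_growth (by norm_num)
      hglip.continuous.aestronglyMeasurable (C := |g 0| + 1) fun p => by
        have := hglip.dist_le_mul p 0
        rw [dist_zero_right, Real.dist_eq, NNReal.coe_one, one_mul] at this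
        have h2 : |g p| ≤ |g p - g 0| + |g 0| := by
          have := abs_add_le (g p - g 0) (g 0)
          rwa [sub_add_cancel] at this
        rw [Real.norm_eq_abs]
        nlinarith [abs_nonneg (g 0), norm_nonneg p]
  have hlim : Tendsto (fun t => ∫ p, g p ∂(γ t : Measure (Eu d₁ × Eu d₂))) (𝓝[Icc t₀ T] s)
      (𝓝 (∫ p, g p ∂(γ s : Measure (Eu d₁ × Eu d₂)))) := by
    rw [tendsto_iff_edist_tendsto_0]
    refine tendsto_of_tendsto_of_tendsto_of_le_of_le' tendsto_const_nhds (hγ.continuous s hs)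
      (Eventually.of_forall fun _ => zero_le) ?_
    filter_upwards [self_mem_nhdsWithin] with t ht
    rw [edist_eq_enorm_sub]
    exact enorm_integral_sub_le_wass₂ hglip (hint t ht) (hint s hs)
  have hgh : ∀ t, ∫ p, h p ∂(γ t : Measure (Eu d₁ × Eu d₂)) =
      l * ∫ p, g p ∂(γ t : Measure (Eu d₁ × Eu d₂)) := fun t => by
    rw [hg, integral_const_mul, mul_inv_cancel_left₀ hl0.ne']
  simp only [hgh]
  exact hlim.const_mul l

/-- Lower semicontinuity of the integral of a continuous function of linear growth: add a multiple
of `1 + ‖p‖`, whose integral is continuous, to make the function nonnegative, and use the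
portmanteau theorem. -/
lemma eventually_lt_integral (hγ : ContinuousCurve t₀ T γ) {s : ℝ} (hs : s ∈ Icc t₀ T)
    {τ : ℕ → ℝ} (hτ : Tendsto τ atTop (𝓝[Icc t₀ T] s))
    {h : Eu d₁ × Eu d₂ → ℝ} (hc : Continuous h) {C : ℝ} (hC : ∀ p, ‖h p‖ ≤ C * (1 + ‖p‖))
    {c : ℝ} (hlt : c < ∫ p, h p ∂(γ s : Measure (Eu d₁ × Eu d₂))) :
    ∀ᶠ n in atTop, c < ∫ p, h p ∂(γ (τ n) : Measure (Eu d₁ × Eu d₂)) := by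
  have hC0 : 0 ≤ C := by
    have := (norm_nonneg _).trans (hC 0)
    simpa using this
  set w : Eu d₁ × Eu d₂ → ℝ := fun p => C * (1 + ‖p‖) with hw
  have hwc : Continuous w := by fun_prop
  have hwlip : LipschitzWith C.toNNReal w := LipschitzWith.of_dist_le_mul fun p q => by
    rw [Real.coe_toNNReal _ hC0, Real.dist_eq, hw, ← mul_sub, abs_mul, abs_of_nonneg hC0,
      add_sub_add_left_eq_sub, dist_eq_norm]
    gcongr
    exact abs_norm_sub_norm_le p q
  have hwlim := (hγ.tendsto_integral_of_lipschitz hs hwlip).comp hτ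
  have hwint : ∀ t ∈ Icc t₀ T, Integrable w (γ t : Measure (Eu d₁ × Eu d₂)) := fun t ht =>
    (hγ.moment t ht).integrable_of_linear_growth (by norm_num) hwc.aestronglyMeasurable (C := C)
      fun p => by rw [Real.norm_of_nonneg (by positivity)]
  have hhint : ∀ t ∈ Icc t₀ T, Integrable h (γ t : Measure (Eu d₁ × Eu d₂)) := fun t ht =>
    (hγ.moment t ht).integrable_of_linear_growth (by norm_num) hc.aestronglyMeasurable hC
  have hsum : ∀ t ∈ Icc t₀ T, ∫ p, (w p + h p) ∂(γ t : Measure (Eu d₁ × Eu d₂)) =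
      ∫ p, w p ∂(γ t : Measure (Eu d₁ × Eu d₂)) + ∫ p, h p ∂(γ t : Measure (Eu d₁ × Eu d₂)) :=
    fun t ht => integral_add (hwint t ht) (hhint t ht)
  have hnn : ∀ p, 0 ≤ w p + h p := fun p => by
    have := neg_abs_le (h p)
    have := hC p
    rw [Real.norm_eq_abs] at this
    simp only [hw]
    linarith
  have hofReal : ∀ t ∈ Icc t₀ T, ∫⁻ p, ENNReal.ofReal (w p + h p) ∂(γ t : Measure (Eu d₁ × Eu d₂)) =
      ENNReal.ofReal (∫ p, (w p + h p) ∂(γ t : Measure (Eu d₁ × Eu d₂))) := fun t ht =>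
    (ofReal_integral_eq_lintegral_ofReal ((hwint t ht).add (hhint t ht)) (ae_of_all _ hnn)).symm
  have hweak : Tendsto (fun n => γ (τ n)) atTop (𝓝 (γ s)) := by
    have : Tendsto γ (𝓝[Icc t₀ T] s) (𝓝 (γ s)) :=
      tendsto_iff_forall_lipschitz_integral_tendsto.2 fun f _ ⟨L, hL⟩ =>
        hγ.tendsto_integral_of_lipschitz hs hL
    exact this.comp hτ
  have hlsc := lintegral_le_liminf_lintegral_of_forall_isOpen_measure_le_liminf_measure
    (μ := (γ s : Measure (Eu d₁ × Eu d₂)))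
    (μs := fun n => (γ (τ n) : Measure (Eu d₁ × Eu d₂))) (hwc.add hc) hnn
    (fun G hG => ProbabilityMeasure.le_liminf_measure_open_of_tendsto hweak hG)
  set δ := (∫ p, h p ∂(γ s : Measure (Eu d₁ × Eu d₂))) - c with hδ
  have hδ0 : 0 < δ := sub_pos.2 hlt
  have hmem : ∀ᶠ n in atTop, τ n ∈ Icc t₀ T := hτ.eventually self_mem_nhdsWithin
  have hup := hwlim.eventually (gt_mem_nhds (lt_add_of_pos_right _ (half_pos hδ0)))
  have hlow : ∀ᶠ n in atTop, (∫ p, (w p + h p) ∂(γ s : Measure (Eu d₁ × Eu d₂))) - δ / 2 <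
      ∫ p, (w p + h p) ∂(γ (τ n) : Measure (Eu d₁ × Eu d₂)) := by
    rcases lt_or_ge ((∫ p, (w p + h p) ∂(γ s : Measure (Eu d₁ × Eu d₂))) - δ / 2) 0 with h0 | h0
    · exact Eventually.of_forall fun n => h0.trans_le (integral_nonneg hnn)
    · have h1 : ENNReal.ofReal ((∫ p, (w p + h p) ∂(γ s : Measure (Eu d₁ × Eu d₂))) - δ / 2) <
          liminf (fun n => ∫⁻ p, ENNReal.ofReal (w p + h p)
            ∂(γ (τ n) : Measure (Eu d₁ × Eu d₂))) atTop := by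
        refine lt_of_lt_of_le ?_ hlsc
        have := hofReal s hs
        simp only [Pi.add_apply] at this ⊢
        rw [this]
        exact (ENNReal.ofReal_lt_ofReal_iff_of_nonneg h0).2 (by linarith)
      filter_upwards [eventually_lt_of_lt_liminf h1, hmem] with n hn hn'
      rw [hofReal _ hn'] at hn
      exact (ENNReal.ofReal_lt_ofReal_iff_of_nonneg h0).1 hn
  filter_upwards [hmem, hup, hlow] with n h1 h2 h3
  rw [hsum _ h1, hsum _ hs] at h3
  simp only [Function.comp_apply] at h2
  linarith

lemma tendsto_integral_of_linear_growth (hγ : ContinuousCurve t₀ T γ) {s : ℝ} (hs : s ∈ Icc t₀ T)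
    {h : Eu d₁ × Eu d₂ → ℝ} (hc : Continuous h) {C : ℝ} (hC : ∀ p, ‖h p‖ ≤ C * (1 + ‖p‖)) :
    Tendsto (fun t => ∫ p, h p ∂(γ t : Measure (Eu d₁ × Eu d₂))) (𝓝[Icc t₀ T] s)
      (𝓝 (∫ p, h p ∂(γ s : Measure (Eu d₁ × Eu d₂)))) := by
  refine tendsto_of_seq_tendsto fun τ hτ => tendsto_order.2 ⟨fun c hlt => ?_, fun c hlt => ?_⟩
  · exact hγ.eventually_lt_integral hs hτ hc hC hlt
  · have := hγ.eventually_lt_integral hs hτ hc.neg (C := C) (c := -c)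
      (fun p => by rw [Pi.neg_apply, norm_neg]; exact hC p)
      (by simp only [Pi.neg_apply, integral_neg]; linarith)
    filter_upwards [this] with n hn
    simp only [Pi.neg_apply, integral_neg] at hn
    exact neg_lt_neg_iff.1 hn

lemma exists_first_moment_le (hγ : ContinuousCurve t₀ T γ) :
    ∃ m : ℝ, 0 ≤ m ∧ ∀ t ∈ Icc t₀ T, ∫ p, (1 + ‖p‖) ∂(γ t : Measure (Eu d₁ × Eu d₂)) ≤ m := by
  have hcont : ContinuousOn (fun t => ∫ p, (1 + ‖p‖) ∂(γ t : Measure (Eu d₁ × Eu d₂)))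
      (Icc t₀ T) := fun s hs =>
    hγ.tendsto_integral_of_linear_growth hs (by fun_prop) (C := 1)
      fun p => by rw [one_mul, Real.norm_of_nonneg (by positivity)]
  obtain ⟨m, hm⟩ := isCompact_Icc.exists_bound_of_continuousOn hcont
  refine ⟨max m 0, le_max_right _ _, fun t ht => ?_⟩
  exact (Real.le_norm_self _).trans ((hm t ht).trans (le_max_left _ _))

lemma continuousOn_integral (hγ : ContinuousCurve t₀ T γ) {h : ℝ → Eu d₁ × Eu d₂ → ℝ}
    (hc : ∀ t ∈ Icc t₀ T, Continuous (h t)) {C K : ℝ}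
    (hC : ∀ t ∈ Icc t₀ T, ∀ p, ‖h t p‖ ≤ C * (1 + ‖p‖))
    (hK : ∀ s ∈ Icc t₀ T, ∀ t ∈ Icc t₀ T, ∀ p,
      ‖h t p - h s p‖ ≤ K * Real.sqrt |t - s| * (1 + ‖p‖)) :
    ContinuousOn (fun t => ∫ p, h t p ∂(γ t : Measure (Eu d₁ × Eu d₂))) (Icc t₀ T) := by
  intro s hs
  obtain ⟨m, hm0, hm⟩ := hγ.exists_first_moment_le
  have hint : ∀ t ∈ Icc t₀ T, ∀ r ∈ Icc t₀ T,
      Integrable (h r) (γ t : Measure (Eu d₁ × Eu d₂)) := fun t ht r hr =>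
    (hγ.moment t ht).integrable_of_linear_growth (by norm_num) (hc r hr).aestronglyMeasurable
      (hC r hr)
  have h1 := hγ.tendsto_integral_of_linear_growth hs (hc s hs) (hC s hs)
  have h2 : Tendsto (fun t => ∫ p, h t p ∂(γ t : Measure (Eu d₁ × Eu d₂)) -
      ∫ p, h s p ∂(γ t : Measure (Eu d₁ × Eu d₂))) (𝓝[Icc t₀ T] s) (𝓝 0) := by
    have hlim : Tendsto (fun t => |K| * Real.sqrt |t - s| * m) (𝓝[Icc t₀ T] s) (𝓝 0) := by
      have : Continuous fun t => |K| * Real.sqrt |t - s| * m := by fun_prop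
      simpa using (this.tendsto s).mono_left nhdsWithin_le_nhds
    refine squeeze_zero_norm' ?_ hlim
    filter_upwards [self_mem_nhdsWithin] with t ht
    rw [← integral_sub (hint t ht t ht) (hint t ht s hs)]
    have hw : Integrable (fun p : Eu d₁ × Eu d₂ => 1 + ‖p‖) (γ t : Measure (Eu d₁ × Eu d₂)) :=
      (hγ.moment t ht).integrable_of_linear_growth (by norm_num)
        (by fun_prop) (C := 1) fun p => by rw [one_mul, Real.norm_of_nonneg (by positivity)]
    calc _ ≤ ∫ p, |K| * Real.sqrt |t - s| * (1 + ‖p‖) ∂(γ t : Measure (Eu d₁ × Eu d₂)) :=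
          norm_integral_le_of_norm_le (hw.const_mul _) (ae_of_all _ fun p =>
            (hK s hs t ht p).trans (by gcongr; exact le_abs_self K))
      _ ≤ _ := by
          rw [integral_const_mul]
          gcongr
          exact hm t ht
  simpa [ContinuousWithinAt] using h2.add h1

end ContinuousCurve

/-! ### Gibbs measures -/

lemma RegularPotential.exists_quadratic_lower_bound {ℓ : Eu d' → ℝ} (hℓ : RegularPotential ℓ) :
    ∃ c : ℝ, 0 < c ∧ ∃ B : ℝ, ∀ a, ℓ 0 - B * ‖a‖ + c * ‖a‖ ^ 2 ≤ ℓ a := by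
  obtain ⟨c, hc, hH⟩ := hℓ.hessian
  refine ⟨c / 2, by positivity, ‖fderiv ℝ ℓ 0‖, fun a => ?_⟩
  have hline : ∀ s : ℝ, HasDerivAt (fun s : ℝ => s • a) a s := fun s => by
    simpa using (hasDerivAt_id s).smul_const a
  have h1 : ∀ s : ℝ, HasDerivAt (fun s => ℓ (s • a)) (fderiv ℝ ℓ (s • a) a) s := fun s =>
    ((hℓ.contDiff.differentiable (by norm_num)) (s • a)).hasFDerivAt.comp_hasDerivAt s (hline s)
  have hD : Differentiable ℝ (fderiv ℝ ℓ) :=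
    (hℓ.contDiff.fderiv_right (m := 1) (by norm_num)).differentiable (by norm_num)
  have h2 : ∀ s : ℝ, HasDerivAt (fun s => fderiv ℝ ℓ (s • a) a)
      (fderiv ℝ (fderiv ℝ ℓ) (s • a) a a) s := fun s => by
    have h3 : HasDerivAt (fun s : ℝ => fderiv ℝ ℓ (s • a)) (fderiv ℝ (fderiv ℝ ℓ) (s • a) a) s :=
      (hD (s • a)).hasFDerivAt.comp_hasDerivAt s (hline s)
    simpa using h3.clm_apply (hasDerivAt_const s a)
  have hmono : Monotone fun s => fderiv ℝ ℓ (s • a) a - c * ‖a‖ ^ 2 * s := by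
    have hd : ∀ s : ℝ, HasDerivAt (fun s => fderiv ℝ ℓ (s • a) a - c * ‖a‖ ^ 2 * s)
        (fderiv ℝ (fderiv ℝ ℓ) (s • a) a a - c * ‖a‖ ^ 2 * 1) s := fun s =>
      (h2 s).sub ((hasDerivAt_id s).const_mul _)
    refine monotone_of_deriv_nonneg (fun s => (hd s).differentiableAt) fun s => ?_
    rw [(hd s).deriv, mul_one, sub_nonneg]
    refine le_trans ?_ (hH (s • a) a)
    gcongr
    nlinarith [sq_nonneg ‖s • a‖]
  have hd : ∀ s : ℝ, HasDerivAt
      (fun s => ℓ (s • a) - s * fderiv ℝ ℓ 0 a - c * ‖a‖ ^ 2 / 2 * s ^ 2)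
      (fderiv ℝ ℓ (s • a) a - 1 * fderiv ℝ ℓ 0 a - c * ‖a‖ ^ 2 / 2 * (2 * s)) s := fun s => by
    have := (hasDerivAt_pow 2 s).const_mul (c * ‖a‖ ^ 2 / 2)
    simp only [Nat.cast_ofNat, Nat.add_one_sub_one, pow_one] at this
    exact ((h1 s).sub ((hasDerivAt_id s).mul_const _)).sub this
  have hmono' : MonotoneOn
      (fun s => ℓ (s • a) - s * fderiv ℝ ℓ 0 a - c * ‖a‖ ^ 2 / 2 * s ^ 2) (Ici 0) := by
    refine monotoneOn_of_deriv_nonneg (convex_Ici 0)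
      (fun s _ => (hd s).continuousAt.continuousWithinAt)
      (fun s _ => (hd s).differentiableAt.differentiableWithinAt) fun s hs => ?_
    rw [interior_Ici] at hs
    rw [(hd s).deriv]
    have := hmono (le_of_lt hs)
    simp only [zero_smul, mul_zero, sub_zero] at this
    linarith
  have h01 := hmono' (mem_Ici.2 le_rfl) (mem_Ici.2 zero_le_one) zero_le_one
  simp only [zero_smul, one_smul] at h01
  have h4 : -(‖fderiv ℝ ℓ 0‖ * ‖a‖) ≤ fderiv ℝ ℓ 0 a :=
    (neg_le_neg ((fderiv ℝ ℓ 0).le_opNorm a)).trans (neg_abs_le _)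
  linarith

lemma RegularPotential.integrable_exp {ℓ : Eu d' → ℝ} (hℓ : RegularPotential ℓ) (k : ℝ) :
    Integrable fun a => Real.exp (k * ‖a‖ - ℓ a) := by
  obtain ⟨c, hc, B, hB⟩ := hℓ.exists_quadratic_lower_bound
  have hG : Integrable fun a : Eu d' => Real.exp (-(c / 2) * ‖a‖ ^ 2) := by
    have := (GaussianFourier.integrable_cexp_neg_mul_sq_norm_add (V := Eu d') (b := ((c / 2 : ℝ) : ℂ))
      (by rw [Complex.ofReal_re]; positivity) 0 0).re
    refine this.congr (ae_of_all _ fun a => ?_)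
    simp only [zero_mul, add_zero]
    have : (-((c / 2 : ℝ) : ℂ) * (‖a‖ : ℂ) ^ 2) = ((-(c / 2) * ‖a‖ ^ 2 : ℝ) : ℂ) := by
      push_cast; ring
    rw [this, ← Complex.ofReal_exp]
    exact Complex.ofReal_re _
  have hℓc := hℓ.contDiff.continuous
  refine (hG.const_mul (Real.exp ((k + B) ^ 2 / (2 * c) - ℓ 0))).mono'
    (by fun_prop) (ae_of_all _ fun a => ?_)
  rw [Real.norm_of_nonneg (Real.exp_pos _).le, ← Real.exp_add, Real.exp_le_exp]
  have h1 : (k + B) * ‖a‖ ≤ (k + B) ^ 2 / (2 * c) + c / 2 * ‖a‖ ^ 2 := by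
    have : (k + B) ^ 2 / (2 * c) + c / 2 * ‖a‖ ^ 2 - (k + B) * ‖a‖ =
        (k + B - c * ‖a‖) ^ 2 / (2 * c) := by field_simp; ring
    have h2 : 0 ≤ (k + B - c * ‖a‖) ^ 2 / (2 * c) := by positivity
    linarith
  have := hB a
  linarith

/-- `f` is a continuous perturbation of the potential `ℓ`, of linear growth with constant `C`. -/
structure LinearPerturbation (ℓ : Eu d' → ℝ) (C : ℝ) (f : Eu d' → ℝ) : Prop where
  continuous : Continuous f
  abs_sub_le : ∀ a, |f a - ℓ a| ≤ C * (1 + ‖a‖)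

namespace LinearPerturbation

variable {ℓ : Eu d' → ℝ} {C : ℝ} {f f₁ f₂ : Eu d' → ℝ}
  {F : Type*} [NormedAddCommGroup F] [NormedSpace ℝ F]

lemma mono {C' : ℝ} (hf : LinearPerturbation ℓ C f)
    (h : C ≤ C') : LinearPerturbation ℓ C' f :=
  ⟨hf.continuous, fun a => (hf.abs_sub_le a).trans (by gcongr)⟩

lemma exp_neg_le (hf : LinearPerturbation ℓ C f) (a : Eu d') :
    Real.exp (-f a) ≤ Real.exp C * Real.exp (C * ‖a‖ - ℓ a) := by
  rw [← Real.exp_add, Real.exp_le_exp]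
  have := (abs_le.1 (hf.abs_sub_le a)).1
  linarith

lemma norm_exp_neg_smul_le (hf : LinearPerturbation ℓ C f) {g : Eu d' → F} {Cg : ℝ}
    (hg : ∀ a, ‖g a‖ ≤ Cg * Real.exp ‖a‖) (a : Eu d') :
    ‖Real.exp (-f a) • g a‖ ≤ Cg * Real.exp C * Real.exp ((C + 1) * ‖a‖ - ℓ a) := by
  rw [norm_smul, Real.norm_of_nonneg (Real.exp_pos _).le]
  calc _ ≤ Real.exp C * Real.exp (C * ‖a‖ - ℓ a) * (Cg * Real.exp ‖a‖) :=
        mul_le_mul (hf.exp_neg_le a) (hg a) (norm_nonneg _) (by positivity)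
    _ = Cg * Real.exp C * (Real.exp (C * ‖a‖ - ℓ a) * Real.exp ‖a‖) := by ring
    _ = _ := by rw [← Real.exp_add]; ring_nf

lemma integrable_exp_neg_smul (hℓ : RegularPotential ℓ) (hf : LinearPerturbation ℓ C f)
    {g : Eu d' → F} (hgc : Continuous g) {Cg : ℝ} (hg : ∀ a, ‖g a‖ ≤ Cg * Real.exp ‖a‖) :
    Integrable fun a => Real.exp (-f a) • g a :=
  ((hℓ.integrable_exp (C + 1)).const_mul (Cg * Real.exp C)).mono'
    ((Real.continuous_exp.comp hf.continuous.neg).smul hgc).aestronglyMeasurable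
    (ae_of_all _ (hf.norm_exp_neg_smul_le hg))

lemma integrable_exp_neg (hℓ : RegularPotential ℓ) (hf : LinearPerturbation ℓ C f) :
    Integrable fun a => Real.exp (-f a) := by
  have := hf.integrable_exp_neg_smul hℓ (g := fun _ => (1 : ℝ)) continuous_const (Cg := 1)
    (fun a => by rw [norm_one, one_mul]; exact Real.one_le_exp (norm_nonneg _))
  simpa using this

lemma integral_gibbs (g : Eu d' → F) :
    ∫ a, g a ∂gibbs f = (∫ a, Real.exp (-f a))⁻¹ • ∫ a, Real.exp (-f a) • g a := by
  rw [gibbs, integral_tilted, ← integral_smul]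
  simp only [smul_smul, div_eq_inv_mul]

lemma integrable_gibbs (hℓ : RegularPotential ℓ) (hf : LinearPerturbation ℓ C f)
    {g : Eu d' → F} (hgc : Continuous g) {Cg : ℝ} (hg : ∀ a, ‖g a‖ ≤ Cg * Real.exp ‖a‖) :
    Integrable g (gibbs f) :=
  (integrable_tilted_iff (hf.integrable_exp_neg hℓ) g).2 (hf.integrable_exp_neg_smul hℓ hgc hg)

/-- The integrals of functions of at most exponential growth against a Gibbs measure are Lipschitz
in the energy, uniformly over linear perturbations of `ℓ`. -/
lemma exists_gibbs_lipschitz (hℓ : RegularPotential ℓ) (C : ℝ) :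
    ∃ Q : ℝ, 0 ≤ Q ∧ ∀ f₁ f₂ : Eu d' → ℝ, LinearPerturbation ℓ C f₁ → LinearPerturbation ℓ C f₂ →
      ∀ Δ : ℝ, (∀ a, |f₁ a - f₂ a| ≤ Δ * Real.exp ‖a‖) →
      ∀ (F : Type) [NormedAddCommGroup F] [NormedSpace ℝ F] (g : Eu d' → F) (Cg : ℝ),
        Continuous g → (∀ a, ‖g a‖ ≤ Cg * Real.exp ‖a‖) →
          ‖∫ a, g a ∂gibbs f₁‖ ≤ Q * Cg ∧
          ‖(∫ a, g a ∂gibbs f₁) - ∫ a, g a ∂gibbs f₂‖ ≤ Q * Cg * Δ := by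
  set Q₁ : ℝ := Real.exp C * ∫ a, Real.exp ((C + 1) * ‖a‖ - ℓ a) with hQ₁
  set Q₂ : ℝ := Real.exp C * ∫ a, Real.exp ((C + 2) * ‖a‖ - ℓ a) with hQ₂
  set z : ℝ := Real.exp (-C) * ∫ a, Real.exp (-C * ‖a‖ - ℓ a) with hz
  have hz0 : 0 < z := mul_pos (Real.exp_pos _) (integral_exp_pos (hℓ.integrable_exp (-C)))
  have hQ₁0 : 0 ≤ Q₁ := mul_nonneg (Real.exp_pos _).le
    (integral_nonneg fun _ => (Real.exp_pos _).le)
  have hQ₂0 : 0 ≤ Q₂ := mul_nonneg (Real.exp_pos _).le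
    (integral_nonneg fun _ => (Real.exp_pos _).le)
  have hlow : ∀ f, LinearPerturbation ℓ C f → z ≤ ∫ a, Real.exp (-f a) := by
    intro f hf
    rw [hz, ← integral_const_mul]
    refine integral_mono ((hℓ.integrable_exp (-C)).const_mul _) (hf.integrable_exp_neg hℓ)
      fun a => ?_
    simp only
    rw [← Real.exp_add, Real.exp_le_exp]
    have := (abs_le.1 (hf.abs_sub_le a)).2
    linarith
  refine ⟨Q₁ / z + (Q₂ / z + Q₁ * Q₂ / (z * z)), by positivity, ?_⟩
  intro f₁ f₂ hf₁ hf₂ Δ hΔ F _ _ g Cg hgc hg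
  have hCg : 0 ≤ Cg := by
    have := (norm_nonneg _).trans (hg 0)
    simpa using this
  have hΔ0 : 0 ≤ Δ := by
    have := (abs_nonneg _).trans (hΔ 0)
    simpa using this
  -- bounds for the unnormalized integrals
  have hI : ∀ (G : Type) [NormedAddCommGroup G] [NormedSpace ℝ G] (g : Eu d' → G) (Cg : ℝ),
      (∀ a, ‖g a‖ ≤ Cg * Real.exp ‖a‖) → ∀ f, LinearPerturbation ℓ C f →
      ‖∫ a, Real.exp (-f a) • g a‖ ≤ Cg * Q₁ := by
    intro G _ _ g Cg hg f hf
    calc _ ≤ ∫ a, Cg * Real.exp C * Real.exp ((C + 1) * ‖a‖ - ℓ a) :=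
          norm_integral_le_of_norm_le ((hℓ.integrable_exp _).const_mul _)
            (ae_of_all _ (hf.norm_exp_neg_smul_le hg))
      _ = _ := by rw [integral_const_mul, hQ₁]; ring
  have hexp : ∀ a, |Real.exp (-f₁ a) - Real.exp (-f₂ a)| ≤
      Δ * Real.exp ‖a‖ * (Real.exp C * Real.exp (C * ‖a‖ - ℓ a)) := by
    have key : ∀ x y M : ℝ, Real.exp x ≤ M → Real.exp x - Real.exp y ≤ |x - y| * M := by
      intro x y M hx
      have h1 : Real.exp x - Real.exp y = Real.exp x * (1 - Real.exp (y - x)) := by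
        rw [mul_sub, mul_one, ← Real.exp_add]; ring_nf
      have h2 := Real.add_one_le_exp (y - x)
      have h3 := le_abs_self (x - y)
      have h4 := Real.exp_pos x
      rw [h1]
      nlinarith [abs_nonneg (x - y)]
    intro a
    have h1 := key (-f₁ a) (-f₂ a) _ (hf₁.exp_neg_le a)
    have h2 := key (-f₂ a) (-f₁ a) _ (hf₂.exp_neg_le a)
    have h3 : |-f₁ a - -f₂ a| = |f₁ a - f₂ a| := by rw [neg_sub_neg, abs_sub_comm]
    have h4 : |-f₂ a - -f₁ a| = |f₁ a - f₂ a| := by rw [neg_sub_neg]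
    rw [h3] at h1
    rw [h4] at h2
    have h5 : |f₁ a - f₂ a| * (Real.exp C * Real.exp (C * ‖a‖ - ℓ a)) ≤
        Δ * Real.exp ‖a‖ * (Real.exp C * Real.exp (C * ‖a‖ - ℓ a)) := by
      gcongr
      exact hΔ a
    rw [abs_le]
    constructor <;> linarith
  have hD : ∀ (G : Type) [NormedAddCommGroup G] [NormedSpace ℝ G] (g : Eu d' → G) (Cg : ℝ),
      Continuous g → (∀ a, ‖g a‖ ≤ Cg * Real.exp ‖a‖) →
      ‖(∫ a, Real.exp (-f₁ a) • g a) - ∫ a, Real.exp (-f₂ a) • g a‖ ≤ Cg * Q₂ * Δ := by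
    intro G _ _ g Cg hgc hg
    rw [← integral_sub (hf₁.integrable_exp_neg_smul hℓ hgc hg)
      (hf₂.integrable_exp_neg_smul hℓ hgc hg)]
    calc _ ≤ ∫ a, Cg * Δ * Real.exp C * Real.exp ((C + 2) * ‖a‖ - ℓ a) := by
          refine norm_integral_le_of_norm_le ((hℓ.integrable_exp _).const_mul _)
            (ae_of_all _ fun a => ?_)
          rw [← sub_smul, norm_smul, Real.norm_eq_abs]
          calc _ ≤ Δ * Real.exp ‖a‖ * (Real.exp C * Real.exp (C * ‖a‖ - ℓ a)) *
                (Cg * Real.exp ‖a‖) := mul_le_mul (hexp a) (hg a) (norm_nonneg _) (by positivity)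
            _ = Cg * Δ * Real.exp C *
                (Real.exp ‖a‖ * Real.exp ‖a‖ * Real.exp (C * ‖a‖ - ℓ a)) := by ring
            _ = _ := by rw [← Real.exp_add, ← Real.exp_add]; ring_nf
      _ = _ := by rw [integral_const_mul, hQ₂]; ring
  set z₁ := ∫ a, Real.exp (-f₁ a) with hz₁
  set z₂ := ∫ a, Real.exp (-f₂ a) with hz₂
  have hz₁z := hlow f₁ hf₁
  have hz₂z := hlow f₂ hf₂
  have hz₁0 : 0 < z₁ := hz0.trans_le hz₁z
  have hz₂0 : 0 < z₂ := hz0.trans_le hz₂z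
  set I₁ := ∫ a, Real.exp (-f₁ a) • g a with hI₁
  set I₂ := ∫ a, Real.exp (-f₂ a) • g a with hI₂
  have hb1 : ‖I₁‖ ≤ Cg * Q₁ := hI F g Cg hg f₁ hf₁
  have hb2 : ‖I₂‖ ≤ Cg * Q₁ := hI F g Cg hg f₂ hf₂
  have hd : ‖I₁ - I₂‖ ≤ Cg * Q₂ * Δ := hD F g Cg hgc hg
  have hdz : |z₁ - z₂| ≤ Q₂ * Δ := by
    have := hD ℝ (fun _ => 1) 1 continuous_const
      (fun a => by rw [norm_one, one_mul]; exact Real.one_le_exp (norm_nonneg _))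
    simpa using this
  rw [integral_gibbs, integral_gibbs]
  constructor
  · rw [norm_smul, norm_inv, Real.norm_of_nonneg hz₁0.le]
    calc z₁⁻¹ * ‖I₁‖ ≤ z⁻¹ * (Cg * Q₁) := by gcongr
      _ = Q₁ / z * Cg := by ring
      _ ≤ _ := by
        gcongr
        have : 0 ≤ Q₂ / z + Q₁ * Q₂ / (z * z) := by positivity
        linarith
  · have hsplit : z₁⁻¹ • I₁ - z₂⁻¹ • I₂ = z₁⁻¹ • (I₁ - I₂) + (z₁⁻¹ * z₂⁻¹ * (z₂ - z₁)) • I₂ := by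
      rw [smul_sub, sub_add, ← sub_smul]
      congr 2
      field_simp
      ring
    rw [hsplit]
    refine (norm_add_le _ _).trans ?_
    rw [norm_smul, norm_smul, norm_mul, norm_mul, norm_inv, norm_inv,
      Real.norm_of_nonneg hz₁0.le, Real.norm_of_nonneg hz₂0.le, Real.norm_eq_abs, abs_sub_comm]
    calc z₁⁻¹ * ‖I₁ - I₂‖ + z₁⁻¹ * z₂⁻¹ * |z₁ - z₂| * ‖I₂‖ ≤
          z⁻¹ * (Cg * Q₂ * Δ) + z⁻¹ * z⁻¹ * (Q₂ * Δ) * (Cg * Q₁) := by gcongr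
      _ = (Q₂ / z + Q₁ * Q₂ / (z * z)) * Cg * Δ := by
          rw [div_eq_mul_inv, div_eq_mul_inv, mul_inv]; ring
      _ ≤ _ := by
        have : 0 ≤ Q₁ / z := by positivity
        exact mul_le_mul_of_nonneg_right (mul_le_mul_of_nonneg_right (by linarith) hCg) hΔ0

lemma continuous_integral_gibbs (hℓ : RegularPotential ℓ) {X : Type*} [TopologicalSpace X]
    [FirstCountableTopology X] {f : X → Eu d' → ℝ} (hf : ∀ x, LinearPerturbation ℓ C (f x))
    (hfc : ∀ a, Continuous fun x => f x a) {g : X → Eu d' → F} (hgc : ∀ x, Continuous (g x))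
    (hgc' : ∀ a, Continuous fun x => g x a) {Cg : ℝ} (hg : ∀ x a, ‖g x a‖ ≤ Cg * Real.exp ‖a‖) :
    Continuous fun x => ∫ a, g x a ∂gibbs (f x) := by
  simp only [integral_gibbs]
  have h : ∀ {G : Type _} [NormedAddCommGroup G] [NormedSpace ℝ G] {g : X → Eu d' → G} {Cg : ℝ},
      (∀ x, Continuous (g x)) → (∀ a, Continuous fun x => g x a) →
      (∀ x a, ‖g x a‖ ≤ Cg * Real.exp ‖a‖) → Continuous fun x => ∫ a, Real.exp (-f x a) • g x a := by
    intro G _ _ g Cg hgc hgc' hg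
    exact continuous_of_dominated
      (fun x => ((hf x).integrable_exp_neg_smul hℓ (hgc x) (hg x)).aestronglyMeasurable)
      (fun x => ae_of_all _ ((hf x).norm_exp_neg_smul_le (hg x)))
      ((hℓ.integrable_exp (C + 1)).const_mul (Cg * Real.exp C))
      (ae_of_all _ fun a => (Real.continuous_exp.comp (hfc a).neg).smul (hgc' a))
  have hz : Continuous fun x => ∫ a, Real.exp (-f x a) :=
    continuous_of_dominated
      (fun x => ((hf x).integrable_exp_neg hℓ).aestronglyMeasurable)
      (fun x => ae_of_all _ fun a => by
        rw [Real.norm_of_nonneg (Real.exp_pos _).le]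
        exact (hf x).exp_neg_le a)
      ((hℓ.integrable_exp C).const_mul (Real.exp C))
      (ae_of_all _ fun a => Real.continuous_exp.comp (hfc a).neg)
  exact (hz.inv₀ fun x => (integral_exp_pos ((hf x).integrable_exp_neg hℓ)).ne').smul
    (h hgc hgc' hg)

/-- A Gibbs measure determines its energy up to an additive constant. -/
lemma eq_of_gibbs_eq (hℓ : RegularPotential ℓ) (hf₁ : LinearPerturbation ℓ C f₁)
    (hf₂ : LinearPerturbation ℓ C f₂) (h : gibbs f₁ = gibbs f₂) (h0 : f₁ 0 = f₂ 0) : f₁ = f₂ := by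
  have hc₁ : Continuous fun a => Real.exp (-f₁ a) / ∫ a, Real.exp (-f₁ a) :=
    (Real.continuous_exp.comp hf₁.continuous.neg).div_const _
  have hc₂ : Continuous fun a => Real.exp (-f₂ a) / ∫ a, Real.exp (-f₂ a) :=
    (Real.continuous_exp.comp hf₂.continuous.neg).div_const _
  have hz₁ := integral_exp_pos (hf₁.integrable_exp_neg hℓ)
  have hz₂ := integral_exp_pos (hf₂.integrable_exp_neg hℓ)
  rw [gibbs, gibbs, Measure.tilted, Measure.tilted, withDensity_eq_iff_of_sigmaFinite
    hc₁.measurable.ennreal_ofReal.aemeasurable hc₂.measurable.ennreal_ofReal.aemeasurable] at h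
  have h' : (fun a => Real.exp (-f₁ a) / ∫ a, Real.exp (-f₁ a)) =
      fun a => Real.exp (-f₂ a) / ∫ a, Real.exp (-f₂ a) := by
    rw [← Continuous.ae_eq_iff_eq volume hc₁ hc₂]
    filter_upwards [h] with a ha
    exact (ENNReal.ofReal_eq_ofReal_iff (by positivity) (by positivity)).1 ha
  have hz : ∫ a, Real.exp (-f₁ a) = ∫ a, Real.exp (-f₂ a) := by
    have := congrFun h' 0
    simp only [h0] at this
    rw [div_eq_div_iff hz₁.ne' hz₂.ne'] at this
    exact (mul_left_cancel₀ (Real.exp_pos _).ne' this).symm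
  funext a
  have : Real.exp (-f₁ a) / _ = Real.exp (-f₂ a) / _ := congrFun h' a
  rw [hz, div_left_inj' hz₂.ne', Real.exp_eq_exp, neg_inj] at this
  exact this

end LinearPerturbation

/-! ### Averages of the vector field -/

/-- The space derivative `∇ₓ b(x, a)`. -/
def derivX (b : Eu d₁ → Eu d' → Eu d₁) (x : Eu d₁) (a : Eu d') : Eu d₁ →L[ℝ] Eu d₁ :=
  fderiv ℝ (fun x' => b x' a) x

lemma norm_mixedDeriv_zero_right (b : Eu d₁ → Eu d' → Eu d₁) (k : ℕ) (x : Eu d₁) (a : Eu d') :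
    ‖mixedDeriv b k 0 x a‖ = ‖iteratedFDeriv ℝ k (fun x' => b x' a) x‖ := by
  rw [mixedDeriv]
  have : (fun x' => iteratedFDeriv ℝ 0 (b x') a) =
      (continuousMultilinearCurryFin0 ℝ (Eu d') (Eu d₁)).symm ∘ fun x' => b x' a := by
    funext x'
    rw [iteratedFDeriv_zero_eq_comp]
    rfl
  rw [this, LinearIsometryEquiv.norm_iteratedFDeriv_comp_left]

namespace RegularField

variable {b : Eu d₁ → Eu d' → Eu d₁}

lemma contDiff_left (hb : RegularField b) (a : Eu d') : ContDiff ℝ 4 fun x => b x a :=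
  hb.contDiff.comp (contDiff_id.prodMk contDiff_const)

lemma hasFDerivAt_left (hb : RegularField b) (a : Eu d') (x : Eu d₁) :
    HasFDerivAt (fun x => b x a) (derivX b x a) x :=
  ((hb.contDiff_left a).differentiable (by norm_num) x).hasFDerivAt

lemma continuous_derivX (hb : RegularField b) :
    Continuous fun p : Eu d₁ × Eu d' => derivX b p.1 p.2 := by
  have h1 : ContDiff ℝ 4 (Function.uncurry fun (p : Eu d₁ × Eu d') (x : Eu d₁) => b x p.2) :=
    hb.contDiff.comp (contDiff_snd.prodMk (contDiff_snd.comp contDiff_fst))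
  have h2 : ContDiff ℝ 1 fun p : Eu d₁ × Eu d' => fderiv ℝ (fun x => b x p.2) p.1 :=
    h1.fderiv contDiff_fst (by norm_num)
  exact h2.continuous

/-- The consequences of the growth assumption that matter: `b`, `∇ₓ b` and the Lipschitz constant of
`∇ₓ b(·, a)` are bounded uniformly in `x`, with polynomial, hence at most exponential, growth in
`a`. -/
lemma exists_bounds (hb : RegularField b) :
    ∃ B : ℝ, 0 ≤ B ∧ (∀ x a, ‖b x a‖ ≤ B * (1 + ‖a‖)) ∧ (∀ x a, ‖b x a‖ ≤ B * Real.exp ‖a‖) ∧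
      (∀ x a, ‖derivX b x a‖ ≤ B * Real.exp ‖a‖) ∧
      ∀ x y a, ‖derivX b x a - derivX b y a‖ ≤ B * ‖x - y‖ * Real.exp ‖a‖ := by
  obtain ⟨C, hC, hg⟩ := hb.growth
  have hpow : ∀ (k : ℕ) (r : ℝ), 0 ≤ r → k ≤ 2 → 1 + r ^ (k + 1) ≤ 7 * Real.exp r := by
    intro k r hr hk
    have h1 := Real.pow_div_factorial_le_exp (x := r) hr (k + 1)
    have h2 := Real.one_le_exp hr
    have h3 : ((k + 1).factorial : ℝ) ≤ 6 := by
      interval_cases k <;> norm_num [Nat.factorial]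
    rw [div_le_iff₀ (by positivity)] at h1
    nlinarith [Real.exp_pos r]
  have hk : ∀ k ≤ 2, ∀ x a, ‖iteratedFDeriv ℝ k (fun x' => b x' a) x‖ ≤ 14 * C * Real.exp ‖a‖ := by
    intro k hk x a
    rw [← norm_mixedDeriv_zero_right]
    refine (hg k 0 (by omega) x a).trans ?_
    have := hpow k ‖a‖ (norm_nonneg _) hk
    calc C * (1 + ‖a‖ ^ (k + 1)) * (1 + ‖x‖ ^ 0) ≤ C * (7 * Real.exp ‖a‖) * (1 + ‖x‖ ^ 0) := by
          gcongr
      _ = _ := by rw [pow_zero]; ring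
  refine ⟨14 * C, by positivity, fun x a => ?_, fun x a => ?_, fun x a => ?_, fun x y a => ?_⟩
  · have := hg 0 0 (by norm_num) x a
    rw [norm_mixedDeriv_zero_right, norm_iteratedFDeriv_zero] at this
    have h2 : 0 ≤ C * (1 + ‖a‖) := by positivity
    simp only [zero_add, pow_one, pow_zero] at this
    linarith
  · simpa only [norm_iteratedFDeriv_zero] using hk 0 (by norm_num) x a
  · rw [derivX, ← norm_iteratedFDeriv_one]
    exact hk 1 (by norm_num) x a
  · have hd : Differentiable ℝ fun x => derivX b x a :=
      ((hb.contDiff_left a).fderiv_right (m := 1) (by norm_num)).differentiable (by norm_num)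
    have h2 : ∀ z, ‖fderiv ℝ (fun x => derivX b x a) z‖ ≤ 14 * C * Real.exp ‖a‖ := fun z => by
      have := hk 2 le_rfl z a
      rw [← norm_iteratedFDeriv_fderiv, norm_iteratedFDeriv_one] at this
      exact this
    have := convex_univ.norm_image_sub_le_of_norm_hasFDerivWithin_le
      (fun z _ => (hd z).hasFDerivAt.hasFDerivWithinAt) (fun z _ => h2 z) (mem_univ y) (mem_univ x)
    linarith

/-- Averaging `b` against a continuous family of Gibbs measures produces a regular vector field. -/
lemma regularVectorField (hb : RegularField b) {ℓ : Eu d' → ℝ} (hℓ : RegularPotential ℓ) (C : ℝ) :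
    ∃ K : ℝ, ∀ f : ℝ → Eu d' → ℝ, (∀ t, LinearPerturbation ℓ C (f t)) →
      (∀ a, Continuous fun t => f t a) →
      RegularVectorField (fun t x => ∫ a, b x a ∂gibbs (f t))
        (fun t x => ∫ a, derivX b x a ∂gibbs (f t)) K := by
  obtain ⟨B, hB0, -, hB, hB', hBL⟩ := hb.exists_bounds
  obtain ⟨Q, hQ0, hQ⟩ := LinearPerturbation.exists_gibbs_lipschitz hℓ C
  have hbc : ∀ x, Continuous (b x) := fun x =>
    hb.contDiff.continuous.comp (continuous_const.prodMk continuous_id)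
  have hbc' : ∀ a, Continuous fun x => b x a := fun a => (hb.contDiff_left a).continuous
  have hDc : ∀ x, Continuous (derivX b x) := fun x =>
    hb.continuous_derivX.comp (continuous_const.prodMk continuous_id)
  have hDc' : ∀ a, Continuous fun x => derivX b x a := fun a =>
    hb.continuous_derivX.comp (continuous_id.prodMk continuous_const)
  refine ⟨Q * B, fun f hf hfc => ⟨?_, fun t x => ?_, fun t x => ?_, ?_, fun t x => ?_,
    fun t x y => ?_⟩⟩
  · exact LinearPerturbation.continuous_integral_gibbs hℓ (f := fun p : ℝ × Eu d₁ => f p.1)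
      (fun p => hf p.1) (fun a => (hfc a).comp continuous_fst) (fun p => hbc p.2)
      (fun a => (hbc' a).comp continuous_snd) (fun p a => hB p.2 a)
  · exact (hQ _ _ (hf t) (hf t) 0 (by simp) _ _ _ (hbc x) (hB x)).1
  · refine hasFDerivAt_integral_of_dominated_of_fderiv_le (s := univ)
      (bound := fun a => B * Real.exp ‖a‖) univ_mem
      (Eventually.of_forall fun x => (hbc x).aestronglyMeasurable)
      ((hf t).integrable_gibbs hℓ (hbc x) (hB x)) (hDc x).aestronglyMeasurable
      (ae_of_all _ fun a z _ => hB' z a)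
      ((hf t).integrable_gibbs hℓ (Cg := B) (by fun_prop) fun a => ?_)
      (ae_of_all _ fun a z _ => hb.hasFDerivAt_left a z)
    rw [Real.norm_of_nonneg (by positivity)]
  · exact LinearPerturbation.continuous_integral_gibbs hℓ (f := fun p : ℝ × Eu d₁ => f p.1)
      (fun p => hf p.1) (fun a => (hfc a).comp continuous_fst) (fun p => hDc p.2)
      (fun a => (hDc' a).comp continuous_snd) (fun p a => hB' p.2 a)
  · exact (hQ _ _ (hf t) (hf t) 0 (by simp) _ _ _ (hDc x) (hB' x)).1
  · rw [← integral_sub ((hf t).integrable_gibbs hℓ (hDc x) (hB' x))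
      ((hf t).integrable_gibbs hℓ (hDc y) (hB' y)), mul_assoc]
    exact (hQ _ _ (hf t) (hf t) 0 (by simp) _ _ _ ((hDc x).sub (hDc y)) (fun a => hBL x y a)).1

end RegularField

/-! ### The backward transport equation -/

lemma gradX_eq {φ : Eu d₁ × Eu d₂ → ℝ} (hφ : Differentiable ℝ φ) (p : Eu d₁ × Eu d₂) :
    gradX φ p = (InnerProductSpace.toDual ℝ (Eu d₁)).symm
      (fderiv ℝ φ p ∘L ContinuousLinearMap.inl ℝ (Eu d₁) (Eu d₂)) := by
  refine ext_inner_left ℝ fun w => ?_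
  rw [inner_gradX (hφ p), real_inner_comm, InnerProductSpace.toDual_symm_apply]
  rfl

lemma continuous_gradX {φ : Eu d₁ × Eu d₂ → ℝ} (hφ : ContDiff ℝ 1 φ) : Continuous (gradX φ) := by
  rw [funext (gradX_eq (hφ.differentiable one_ne_zero))]
  exact (LinearIsometryEquiv.continuous _).comp
    ((hφ.continuous_fderiv one_ne_zero).clm_comp continuous_const)

lemma gradX_sub {φ ψ : Eu d₁ × Eu d₂ → ℝ} (hφ : Differentiable ℝ φ) (hψ : Differentiable ℝ ψ)
    (p : Eu d₁ × Eu d₂) : gradX (fun p => φ p - ψ p) p = gradX φ p - gradX ψ p := by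
  have hsub : Differentiable ℝ fun p => φ p - ψ p := hφ.sub hψ
  rw [gradX_eq hsub, gradX_eq hφ, gradX_eq hψ, ← map_sub, ← ContinuousLinearMap.sub_comp,
    ← fderiv_fun_sub (hφ p) (hψ p)]

lemma GrowthBound.norm_gradX_le {φ : Eu d₁ × Eu d₂ → ℝ} {K : ℝ} (hφ : Differentiable ℝ φ)
    (h : GrowthBound K φ) (p : Eu d₁ × Eu d₂) : ‖gradX φ p‖ ≤ 2 * |K| * (1 + ‖p‖) := by
  rw [gradX_eq hφ, LinearIsometryEquiv.norm_map]
  have h1 := (ContinuousLinearMap.opNorm_comp_le (fderiv ℝ φ p)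
    (ContinuousLinearMap.inl ℝ (Eu d₁) (Eu d₂))).trans
    (mul_le_of_le_one_right (norm_nonneg _) (ContinuousLinearMap.norm_inl_le_one ℝ _ _))
  refine (h1.trans (h p).2).trans ?_
  have hx := norm_fst_le p
  have hy := norm_snd_le p
  calc K * (1 + ‖p.1‖ + ‖p.2‖) ≤ |K| * (1 + ‖p‖ + ‖p‖) := by
        gcongr
        exact le_abs_self K
    _ ≤ |K| * (2 * (1 + ‖p‖)) := by gcongr; linarith
    _ = _ := by ring

/-- The method of characteristics: a solution of `∂ₜ U = -g` is constant along a curve `α` as soon as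
the space derivative of `U` in the direction of `α'` equals `g` along `α`. -/
lemma apply_eq_of_characteristic {P : Type*} [NormedAddCommGroup P] [NormedSpace ℝ P] {t₀ T : ℝ}
    (hT : t₀ < T) {U g : ℝ → P → ℝ} (hgc : Continuous fun q : ℝ × P => g q.1 q.2)
    (hdiff : ∀ s ∈ Icc t₀ T, ∀ r ∈ Icc t₀ T, ∀ p, U r p - U s p = -∫ τ in s..r, g τ p)
    {α : ℝ → P} (hα : ∀ s, ContinuousAt α s)
    (hU : ∀ s ∈ Icc t₀ T, HasDerivAt (fun r => U s (α r)) (g s (α s)) s) :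
    ∀ t ∈ Icc t₀ T, U t (α t) = U t₀ (α t₀) := by
  have hgt : ∀ p, Continuous fun s => g s p := fun p =>
    hgc.comp (continuous_id.prodMk continuous_const)
  have hw : ∀ s ∈ Icc t₀ T, HasDerivWithinAt (fun r => U r (α r)) 0 (Icc t₀ T) s := by
    intro s hs
    have hB : HasDerivWithinAt (fun r => U r (α r) - U s (α r)) (-g s (α s)) (Icc t₀ T) s := by
      rw [hasDerivWithinAt_iff_isLittleO, Asymptotics.isLittleO_iff]
      intro c hc
      obtain ⟨δ, hδ, hgδ⟩ := Metric.continuousAt_iff.1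
        (hgc.continuousAt (x := (s, α s))) c hc
      obtain ⟨η, hη, hαη⟩ := Metric.continuousAt_iff.1 (hα s) δ hδ
      filter_upwards [self_mem_nhdsWithin,
        mem_nhdsWithin_of_mem_nhds (Metric.ball_mem_nhds s (lt_min hδ hη))] with r hr hr'
      rw [Metric.mem_ball, lt_min_iff] at hr'
      have hint : ‖∫ τ in s..r, (g τ (α r) - g s (α s))‖ ≤ c * |r - s| := by
        refine intervalIntegral.norm_integral_le_of_norm_le_const fun τ hτ => ?_
        rw [← dist_eq_norm]
        refine (hgδ (x := (τ, α r)) ?_).le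
        rw [Prod.dist_eq, max_lt_iff]
        refine ⟨lt_of_le_of_lt ?_ hr'.1, hαη hr'.2⟩
        rw [Real.dist_eq, Real.dist_eq]
        exact abs_sub_left_of_mem_uIcc (uIoc_subset_uIcc hτ)
      rw [intervalIntegral.integral_sub ((hgt _).intervalIntegrable _ _)
        (intervalIntegrable_const), intervalIntegral.integral_const] at hint
      rw [hdiff s hs r hr, sub_self, sub_zero, smul_neg, sub_neg_eq_add, ← norm_neg, neg_add,
        neg_neg, ← sub_eq_add_neg, Real.norm_eq_abs (r - s)]
      exact hint
    have := hB.add (hU s hs).hasDerivWithinAt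
    rw [neg_add_cancel] at this
    refine this.congr_of_eventuallyEq (Eventually.of_forall fun r => ?_) ?_
    · simp
    · simp
  exact constant_of_derivWithin_zero (fun s hs => (hw s hs).differentiableWithinAt)
    (fun s hs => (hw s ⟨hs.1, hs.2.le⟩).derivWithin
      (uniqueDiffOn_Icc hT s ⟨hs.1, hs.2.le⟩))

namespace SolvesTransport

variable {b : Eu d₁ → Eu d' → Eu d₁} {L : Eu d₁ × Eu d₂ → ℝ} {t₀ T : ℝ}
  {ν : ℝ → ProbabilityMeasure (Eu d')} {u : ℝ → Eu d₁ × Eu d₂ → ℝ}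

lemma exists_gradX_bounds (hu : SolvesTransport b L t₀ T ν u) (hT : t₀ ≤ T) :
    ∃ G : ℝ, 0 ≤ G ∧ (∀ t ∈ Icc t₀ T, ∀ p, ‖gradX (u t) p‖ ≤ G * (1 + ‖p‖)) ∧
      ∀ s ∈ Icc t₀ T, ∀ t ∈ Icc t₀ T, ∀ p,
        ‖gradX (u t) p - gradX (u s) p‖ ≤ G * Real.sqrt |t - s| * (1 + ‖p‖) := by
  have h0 : t₀ ∈ Icc t₀ T := ⟨le_rfl, hT⟩
  obtain ⟨K₀, hK₀⟩ := hu.growth t₀ h0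
  obtain ⟨K, hK⟩ := hu.holder
  have hd : ∀ t ∈ Icc t₀ T, Differentiable ℝ (u t) := fun t ht =>
    (hu.contDiff t ht).differentiable one_ne_zero
  have hH : ∀ s ∈ Icc t₀ T, ∀ t ∈ Icc t₀ T, ∀ p,
      ‖gradX (u t) p - gradX (u s) p‖ ≤ 2 * |K| * Real.sqrt |t - s| * (1 + ‖p‖) := by
    intro s hs t ht p
    rw [← gradX_sub (hd t ht) (hd s hs)]
    refine ((hK s hs t ht).norm_gradX_le ((hd t ht).sub (hd s hs)) p).trans (le_of_eq ?_)
    rw [abs_mul, abs_of_nonneg (Real.sqrt_nonneg _)]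
    ring
  refine ⟨2 * |K₀| + 2 * |K| * Real.sqrt |T - t₀| + 2 * |K|, by positivity, fun t ht p => ?_,
    fun s hs t ht p => (hH s hs t ht p).trans ?_⟩
  · have h1 := hK₀.norm_gradX_le (hd t₀ h0) p
    have h2 := hH t₀ h0 t ht p
    have h3 : Real.sqrt |t - t₀| ≤ Real.sqrt |T - t₀| := by
      apply Real.sqrt_le_sqrt
      rw [abs_of_nonneg (by linarith [ht.1]), abs_of_nonneg (by linarith)]
      linarith [ht.2]
    have h4 : 2 * |K| * Real.sqrt |t - t₀| * (1 + ‖p‖) ≤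
        2 * |K| * Real.sqrt |T - t₀| * (1 + ‖p‖) := by gcongr
    have h5 : ‖gradX (u t) p‖ ≤ ‖gradX (u t) p - gradX (u t₀) p‖ + ‖gradX (u t₀) p‖ := by
      have := norm_add_le (gradX (u t) p - gradX (u t₀) p) (gradX (u t₀) p)
      rwa [sub_add_cancel] at this
    have h6 : 0 ≤ 2 * |K| * (1 + ‖p‖) := by positivity
    linarith
  · gcongr
    have : 0 ≤ 2 * |K₀| + 2 * |K| * Real.sqrt |T - t₀| := by positivity
    linarith

lemma continuous_gradX_projIcc (hu : SolvesTransport b L t₀ T ν u) (hT : t₀ ≤ T) :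
    Continuous fun q : ℝ × (Eu d₁ × Eu d₂) => gradX (u (projIcc t₀ T hT q.1)) q.2 := by
  obtain ⟨G, hG0, -, hG⟩ := hu.exists_gradX_bounds hT
  refine continuous_iff_continuousAt.2 fun ⟨t, p⟩ => ?_
  rw [ContinuousAt, tendsto_iff_norm_sub_tendsto_zero]
  have hpr : Continuous fun t => (projIcc t₀ T hT t : ℝ) :=
    continuous_subtype_val.comp continuous_projIcc
  have hg : Continuous (gradX (u (projIcc t₀ T hT t))) :=
    continuous_gradX (hu.contDiff _ (projIcc t₀ T hT t).2)
  have hbound : Continuous fun q : ℝ × (Eu d₁ × Eu d₂) =>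
      G * Real.sqrt |(projIcc t₀ T hT q.1 : ℝ) - projIcc t₀ T hT t| * (1 + ‖q.2‖) +
        ‖gradX (u (projIcc t₀ T hT t)) q.2 - gradX (u (projIcc t₀ T hT t)) p‖ := by
    have h1 := hpr.comp (continuous_fst : Continuous (Prod.fst : ℝ × (Eu d₁ × Eu d₂) → ℝ))
    have h2 := hg.comp (continuous_snd : Continuous (Prod.snd : ℝ × (Eu d₁ × Eu d₂) → _))
    simp only [Function.comp_def] at h1 h2
    fun_prop
  refine squeeze_zero (fun _ => norm_nonneg _) (fun q => ?_)
    (by simpa using hbound.tendsto (t, p))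
  calc _ = ‖(gradX (u (projIcc t₀ T hT q.1)) q.2 - gradX (u (projIcc t₀ T hT t)) q.2) +
        (gradX (u (projIcc t₀ T hT t)) q.2 - gradX (u (projIcc t₀ T hT t)) p)‖ := by
          rw [sub_add_sub_cancel]
    _ ≤ _ := (norm_add_le _ _).trans (add_le_add_left
      (hG _ (projIcc t₀ T hT t).2 _ (projIcc t₀ T hT q.1).2 q.2) _)

variable {v : ℝ → Eu d₁ → Eu d₁} {A : ℝ → Eu d₁ → Eu d₁ →L[ℝ] Eu d₁} {K : ℝ}

/-- The multiplier is constant along the characteristics. -/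
lemma apply_flow (hu : SolvesTransport b L t₀ T ν u) (hT : t₀ < T)
    (hv : RegularVectorField v A K) (hvν : ∀ t ∈ Icc t₀ T, ∀ x, v t x = avg b x (ν t))
    {t : ℝ} (ht : t ∈ Icc t₀ T) (x : Eu d₁) (y : Eu d₂) :
    u t (hv.flow t₀ t x, y) = u t₀ (x, y) := by
  have hαd : ∀ t, HasDerivAt (fun t => (hv.flow t₀ t x, y)) (v t (hv.flow t₀ t x), 0) t := fun t =>
    (hv.hasDerivAt_flow t₀ t x).prodMk (hasDerivAt_const t y)
  obtain ⟨g, hg⟩ : ∃ g : ℝ → Eu d₁ × Eu d₂ → ℝ,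
      ∀ s p, g s p = inner ℝ (v s p.1) (gradX (u (projIcc t₀ T hT.le s)) p) := ⟨_, fun _ _ => rfl⟩
  have hgc : Continuous fun q : ℝ × (Eu d₁ × Eu d₂) => g q.1 q.2 := by
    simp only [hg]
    exact (hv.continuous.comp (continuous_fst.prodMk (continuous_fst.comp continuous_snd))).inner
      (hu.continuous_gradX_projIcc hT.le)
  have hgt : ∀ p, Continuous fun s => g s p := fun p =>
    hgc.comp (continuous_id.prodMk continuous_const)
  have hL : ∀ t ∈ Icc t₀ T, ∀ p, u t p = L p + ∫ τ in t..T, g τ p := by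
    intro t ht p
    rw [hu.equation t ht p]
    congr 1
    refine intervalIntegral.integral_congr fun s hs => ?_
    rw [uIcc_of_le ht.2] at hs
    have hs' : s ∈ Icc t₀ T := ⟨ht.1.trans hs.1, hs.2⟩
    simp only [hg, projIcc_of_mem hT.le hs', hvν s hs']
  have hdiff : ∀ s ∈ Icc t₀ T, ∀ r ∈ Icc t₀ T, ∀ p, u r p - u s p = -∫ τ in s..r, g τ p := by
    intro s hs r hr p
    rw [hL s hs, hL r hr, ← intervalIntegral.integral_add_adjacent_intervals
      ((hgt p).intervalIntegrable s r) ((hgt p).intervalIntegrable r T)]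
    ring
  have := apply_eq_of_characteristic hT hgc hdiff
    (α := fun t => (hv.flow t₀ t x, y)) (fun s => (hαd s).continuousAt) (fun s hs => by
      have hus := (hu.contDiff s hs).differentiable one_ne_zero (hv.flow t₀ s x, y)
      have := hus.hasFDerivAt.comp_hasDerivAt s (hαd s)
      rw [← inner_gradX hus] at this
      rw [hg, projIcc_of_mem hT.le hs]
      exact this) t ht
  rwa [hv.flow_self] at this

/-- The evolution of `∇ₓu` along the characteristics, obtained by differentiating
`u t (x, y) = u t₀ (flow t t₀ x, y)` in `x`. -/
lemma inner_gradX_flow (hu : SolvesTransport b L t₀ T ν u) (hT : t₀ < T)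
    (hv : RegularVectorField v A K) (hvν : ∀ t ∈ Icc t₀ T, ∀ x, v t x = avg b x (ν t))
    {t : ℝ} (ht : t ∈ Icc t₀ T) (p : Eu d₁ × Eu d₂) (w : Eu d₁) :
    inner ℝ w (gradX (u t) (hv.flow t₀ t p.1, p.2)) =
      inner ℝ (hv.invDeriv t₀ t p.1 w) (gradX (u t₀) p) := by
  have hd : ∀ t ∈ Icc t₀ T, Differentiable ℝ (u t) := fun t ht =>
    (hu.contDiff t ht).differentiable one_ne_zero
  have h0 : t₀ ∈ Icc t₀ T := ⟨le_rfl, hT.le⟩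
  rw [inner_gradX (hd t ht _), inner_gradX (hd t₀ h0 p)]
  have h1 : HasFDerivAt (fun x => u t (x, p.2)) (fderiv ℝ (u t) (hv.flow t₀ t p.1, p.2) ∘L
      ContinuousLinearMap.inl ℝ (Eu d₁) (Eu d₂)) (hv.flow t₀ t p.1) :=
    HasFDerivAt.comp (hv.flow t₀ t p.1) (f := fun x => (x, p.2))
      (hd t ht (hv.flow t₀ t p.1, p.2)).hasFDerivAt (hasFDerivAt_prodMk_left _ p.2)
  have h2 : HasFDerivAt (fun x => u t (x, p.2)) ((fderiv ℝ (u t₀) p ∘L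
      ContinuousLinearMap.inl ℝ (Eu d₁) (Eu d₂)) ∘L hv.invDeriv t₀ t p.1)
      (hv.flow t₀ t p.1) := by
    have h3 : HasFDerivAt (fun x => u t₀ (x, p.2)) (fderiv ℝ (u t₀) p ∘L
        ContinuousLinearMap.inl ℝ (Eu d₁) (Eu d₂)) (hv.flow t t₀ (hv.flow t₀ t p.1)) := by
      rw [hv.flow_flow, hv.flow_self]
      exact HasFDerivAt.comp p.1 (f := fun x => (x, p.2)) (hd t₀ h0 p).hasFDerivAt
        (hasFDerivAt_prodMk_left _ p.2)
    refine (HasFDerivAt.comp _ h3 (hv.hasFDerivAt_flow t₀ t p.1)).congr_of_eventuallyEq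
      (Eventually.of_forall fun x => ?_)
    have := hu.apply_flow hT hv hvν ht (hv.flow t t₀ x) p.2
    rw [hv.flow_flow, hv.flow_self] at this
    exact this
  have := congrArg (fun l => l w) (h1.unique h2)
  simpa using this

end SolvesTransport

/-! ### The energy along a solution of the optimality system -/

/-- The energy `ℓ(a) + ε⁻¹ ∫ b(x, a) · ∇ₓφ(x, y) dμ(x, y)` of which the optimal control is the Gibbs
measure. -/
def energy (b : Eu d₁ → Eu d' → Eu d₁) (ℓ : Eu d' → ℝ) (ε : ℝ)
    (μ : ProbabilityMeasure (Eu d₁ × Eu d₂)) (φ : Eu d₁ × Eu d₂ → ℝ) (a : Eu d') : ℝ :=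
  ℓ a + 1 / ε * ∫ p, inner ℝ (b p.1 a) (gradX φ p) ∂(μ : Measure (Eu d₁ × Eu d₂))

namespace SolvesOptimalitySystem

variable {b : Eu d₁ → Eu d' → Eu d₁} {ℓ : Eu d' → ℝ} {L : Eu d₁ × Eu d₂ → ℝ} {ε t₀ T : ℝ}
  {γ₀ : ProbabilityMeasure (Eu d₁ × Eu d₂)} {ν : ℝ → ProbabilityMeasure (Eu d')}
  {γ : ℝ → ProbabilityMeasure (Eu d₁ × Eu d₂)} {u : ℝ → Eu d₁ × Eu d₂ → ℝ}

lemma exists_linearPerturbation_energy (h : SolvesOptimalitySystem b ℓ L ε t₀ T γ₀ ν γ u)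
    (hb : RegularField b) (hℓ : RegularPotential ℓ) (hT : t₀ ≤ T) :
    ∃ C : ℝ, ∀ t ∈ Icc t₀ T, LinearPerturbation ℓ C (energy b ℓ ε (γ t) (u t)) := by
  obtain ⟨B, hB0, hB, -⟩ := hb.exists_bounds
  obtain ⟨G, hG0, hG, -⟩ := h.multiplier.exists_gradX_bounds hT
  obtain ⟨m, hm0, hm⟩ := h.curve.curve.exists_first_moment_le
  have hbc : Continuous fun q : Eu d₁ × Eu d' => b q.1 q.2 := hb.contDiff.continuous
  refine ⟨|1 / ε| * (B * G * m), fun t ht => ?_⟩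
  have hgc : Continuous (gradX (u t)) := continuous_gradX (h.multiplier.contDiff t ht)
  have hle : ∀ a p, ‖(inner ℝ (b p.1 a) (gradX (u t) p) : ℝ)‖ ≤
      B * (1 + ‖a‖) * (G * (1 + ‖p‖)) := fun a p =>
    (norm_inner_le_norm _ _).trans
      (mul_le_mul (hB _ _) (hG t ht p) (norm_nonneg _) (by positivity))
  have hw : Integrable (fun p : Eu d₁ × Eu d₂ => 1 + ‖p‖) (γ t : Measure (Eu d₁ × Eu d₂)) :=
    (h.curve.curve.moment t ht).integrable_of_linear_growth (by norm_num)
      (by fun_prop) (C := 1) fun p => by rw [one_mul, Real.norm_of_nonneg (by positivity)]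
  have hcont : ∀ a, Continuous fun p : Eu d₁ × Eu d₂ =>
      (inner ℝ (b p.1 a) (gradX (u t) p) : ℝ) := fun a =>
    (hbc.comp (continuous_fst.prodMk continuous_const)).inner hgc
  constructor
  · refine hℓ.contDiff.continuous.add (continuous_const.mul ?_)
    refine continuous_iff_continuousAt.2 fun a₀ => ?_
    refine continuousAt_of_dominated (bound := fun p => B * (1 + (‖a₀‖ + 1)) * (G * (1 + ‖p‖)))
      (Eventually.of_forall fun a => (hcont a).aestronglyMeasurable) ?_
      ((hw.const_mul G).const_mul _) (ae_of_all _ fun p => ?_)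
    · filter_upwards [Metric.ball_mem_nhds a₀ one_pos] with a ha
      refine ae_of_all _ fun p => (hle a p).trans ?_
      have : ‖a‖ ≤ ‖a₀‖ + 1 := by
        rw [mem_ball_iff_norm] at ha
        have := norm_sub_norm_le a a₀
        linarith
      gcongr
    · exact ((hbc.comp (continuous_const.prodMk continuous_id)).inner
        continuous_const).continuousAt
  · intro a
    rw [energy, add_sub_cancel_left, abs_mul, mul_assoc]
    gcongr
    calc _ ≤ ∫ p, B * (1 + ‖a‖) * (G * (1 + ‖p‖)) ∂(γ t : Measure (Eu d₁ × Eu d₂)) :=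
          norm_integral_le_of_norm_le ((hw.const_mul G).const_mul _) (ae_of_all _ (hle a))
      _ = B * (1 + ‖a‖) * (G * ∫ p, (1 + ‖p‖) ∂(γ t : Measure (Eu d₁ × Eu d₂))) := by
          rw [integral_const_mul, integral_const_mul]
      _ ≤ B * (1 + ‖a‖) * (G * m) := by
          gcongr
          exact hm t ht
      _ = _ := by ring

lemma continuousOn_energy (h : SolvesOptimalitySystem b ℓ L ε t₀ T γ₀ ν γ u)
    (hb : RegularField b) (hT : t₀ ≤ T) (a : Eu d') :
    ContinuousOn (fun t => energy b ℓ ε (γ t) (u t) a) (Icc t₀ T) := by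
  obtain ⟨B, hB0, hB, -⟩ := hb.exists_bounds
  obtain ⟨G, hG0, hG, hGH⟩ := h.multiplier.exists_gradX_bounds hT
  refine continuousOn_const.add (continuousOn_const.mul ?_)
  refine h.curve.curve.continuousOn_integral (C := B * (1 + ‖a‖) * G) (K := B * (1 + ‖a‖) * G)
    (fun t ht => ?_) (fun t ht p => ?_) (fun s hs t ht p => ?_)
  · exact ((hb.contDiff_left a).continuous.comp continuous_fst).inner
      (continuous_gradX (h.multiplier.contDiff t ht))
  · refine (norm_inner_le_norm _ _).trans ?_
    rw [mul_assoc]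
    exact mul_le_mul (hB _ _) (hG t ht p) (norm_nonneg _) (by positivity)
  · rw [← inner_sub_right]
    refine (norm_inner_le_norm _ _).trans ?_
    rw [mul_assoc, mul_assoc (B * (1 + ‖a‖)), ← mul_assoc G]
    exact mul_le_mul (hB _ _) (hGH s hs t ht p) (norm_nonneg _) (by positivity)

/-- The energy at time `t`, pulled back to the initial time along the characteristics. -/
lemma energy_eq (h : SolvesOptimalitySystem b ℓ L ε t₀ T γ₀ ν γ u) (hb : RegularField b)
    (hT : t₀ < T) {v : ℝ → Eu d₁ → Eu d₁} {A : ℝ → Eu d₁ → Eu d₁ →L[ℝ] Eu d₁} {K : ℝ}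
    (hv : RegularVectorField v A K) (hvν : ∀ t ∈ Icc t₀ T, ∀ x, v t x = avg b x (ν t))
    {t : ℝ} (ht : t ∈ Icc t₀ T) (a : Eu d') :
    energy b ℓ ε (γ t) (u t) a = ℓ a + 1 / ε * ∫ p,
      inner ℝ (hv.invDeriv t₀ t p.1 (b (hv.flow t₀ t p.1) a)) (gradX (u t₀) p)
        ∂(γ₀ : Measure (Eu d₁ × Eu d₂)) := by
  have hcont : Continuous fun p : Eu d₁ × Eu d₂ => (inner ℝ (b p.1 a) (gradX (u t) p) : ℝ) :=
    ((hb.contDiff_left a).continuous.comp continuous_fst).inner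
      (continuous_gradX (h.multiplier.contDiff t ht))
  rw [energy, h.curve.eq_map_flow hv hvν ht,
    integral_map (measurable_flow_prodMap hv t₀ t).aemeasurable hcont.aestronglyMeasurable]
  simp only [h.multiplier.inner_gradX_flow hT hv hvν ht]

end SolvesOptimalitySystem

/-- The discriminating property extends the equality of the moments of two functions against the
fields `b(·, a)` to their moments against all bounded functions of `x`: both functions have the
same conditional expectation given `x`. -/
lemma Discriminating.integral_inner_eq {b : Eu d₁ → Eu d' → Eu d₁} (hdis : Discriminating b)
    (hbc : ∀ a, Continuous fun x => b x a) (hbb : ∀ a, ∃ B, ∀ x, ‖b x a‖ ≤ B)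
    {μ : ProbabilityMeasure (Eu d₁ × Eu d₂)} {ζ₁ ζ₂ : Eu d₁ × Eu d₂ → Eu d₁}
    (hc₁ : Continuous ζ₁) (hc₂ : Continuous ζ₂) (hi₁ : Integrable ζ₁ μ) (hi₂ : Integrable ζ₂ μ)
    (heq : ∀ a, ∫ p, inner ℝ (b p.1 a) (ζ₁ p) ∂(μ : Measure (Eu d₁ × Eu d₂)) =
      ∫ p, inner ℝ (b p.1 a) (ζ₂ p) ∂(μ : Measure (Eu d₁ × Eu d₂)))
    {w : Eu d₁ → Eu d₁} (hw : Continuous w) {B : ℝ} (hB : ∀ x, ‖w x‖ ≤ B) :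
    ∫ p, inner ℝ (w p.1) (ζ₁ p) ∂(μ : Measure (Eu d₁ × Eu d₂)) =
      ∫ p, inner ℝ (w p.1) (ζ₂ p) ∂(μ : Measure (Eu d₁ × Eu d₂)) := by
  have hint : ∀ {w : Eu d₁ → Eu d₁} {B : ℝ}, Continuous w → (∀ x, ‖w x‖ ≤ B) →
      ∀ {ζ : Eu d₁ × Eu d₂ → Eu d₁}, Continuous ζ → Integrable ζ (μ : Measure (Eu d₁ × Eu d₂)) →
      Integrable (fun p => (inner ℝ (w p.1) (ζ p) : ℝ)) (μ : Measure (Eu d₁ × Eu d₂)) := by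
    intro w B hw hB ζ hζ hζi
    refine (hζi.norm.const_mul B).mono' ((hw.comp continuous_fst).inner hζ).aestronglyMeasurable
      (ae_of_all _ fun p => (norm_inner_le_norm _ _).trans ?_)
    gcongr
    exact hB _
  have hζi : Integrable (fun p => ζ₁ p - ζ₂ p) (μ : Measure (Eu d₁ × Eu d₂)) := hi₁.sub hi₂
  have hcond := hdis (Eu d₁ × Eu d₂) (μ : Measure (Eu d₁ × Eu d₂)) Prod.fst
    (fun p => ζ₁ p - ζ₂ p) measurable_fst (hc₁.sub hc₂).measurable hζi (fun a => by
      obtain ⟨B, hB⟩ := hbb a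
      simp only [inner_sub_right]
      rw [integral_sub (hint (hbc a) hB hc₁ hi₁) (hint (hbc a) hB hc₂ hi₂), heq a, sub_self])
  have hle : MeasurableSpace.comap (Prod.fst : Eu d₁ × Eu d₂ → Eu d₁) inferInstance ≤
      (inferInstance : MeasurableSpace (Eu d₁ × Eu d₂)) := measurable_fst.comap_le
  have hwm : StronglyMeasurable[MeasurableSpace.comap (Prod.fst : Eu d₁ × Eu d₂ → Eu d₁)
      inferInstance] fun p : Eu d₁ × Eu d₂ => w p.1 :=
    (hw.measurable.comp (comap_measurable Prod.fst)).stronglyMeasurable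
  have hpull := condExp_bilin_of_stronglyMeasurable_left
    (μ := (μ : Measure (Eu d₁ × Eu d₂))) (innerSL ℝ) hwm
    (g := fun p => ζ₁ p - ζ₂ p) (hint hw hB (hc₁.sub hc₂) hζi) hζi
  rw [← sub_eq_zero, ← integral_sub (hint hw hB hc₁ hi₁) (hint hw hB hc₂ hi₂)]
  simp only [← inner_sub_right]
  rw [← integral_condExp hle]
  refine (integral_congr_ae (hpull.trans ?_)).trans (integral_zero _ _)
  filter_upwards [hcond] with p hp
  rw [hp]
  simp

namespace SolvesOptimalitySystem

variable {b : Eu d₁ → Eu d' → Eu d₁} {ℓ : Eu d' → ℝ} {L : Eu d₁ × Eu d₂ → ℝ} {ε t₀ T C : ℝ}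
  {γ₀ : ProbabilityMeasure (Eu d₁ × Eu d₂)} {ν : ℝ → ProbabilityMeasure (Eu d')}
  {γ : ℝ → ProbabilityMeasure (Eu d₁ × Eu d₂)} {u : ℝ → Eu d₁ × Eu d₂ → ℝ}

/-- The energies, frozen before `t₀` and after `T`. -/
lemma exists_energy_extension (h : SolvesOptimalitySystem b ℓ L ε t₀ T γ₀ ν γ u)
    (hb : RegularField b) (hT : t₀ ≤ T)
    (hC : ∀ t ∈ Icc t₀ T, LinearPerturbation ℓ C (energy b ℓ ε (γ t) (u t))) :
    ∃ f : ℝ → Eu d' → ℝ, (∀ t ∈ Icc t₀ T, f t = energy b ℓ ε (γ t) (u t)) ∧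
      (∀ t, LinearPerturbation ℓ C (f t)) ∧ ∀ a, Continuous fun t => f t a :=
  ⟨fun t => energy b ℓ ε (γ (projIcc t₀ T hT t)) (u (projIcc t₀ T hT t)),
    fun t ht => by simp only [projIcc_of_mem hT ht], fun t => hC _ (projIcc t₀ T hT t).2,
    fun a => (continuousOn_iff_continuous_domRestrict.1 (h.continuousOn_energy hb hT a)).comp
      (continuous_projIcc (h := hT))⟩

end SolvesOptimalitySystem

/-- Energies obtained by pulling back along two close flows are close. -/
lemma abs_integral_inner_sub_le {b : Eu d₁ → Eu d' → Eu d₁} {B R S : ℝ} {a : Eu d'}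
    (hbc : Continuous fun x => b x a) (hB : ∀ x, ‖b x a‖ ≤ B) (hB0 : 0 ≤ B)
    (hBL : ∀ x y, ‖b x a - b y a‖ ≤ B * ‖x - y‖)
    {μ : ProbabilityMeasure (Eu d₁ × Eu d₂)} {ζ : Eu d₁ × Eu d₂ → Eu d₁} (hζ : Continuous ζ)
    (hζi : Integrable ζ μ) {X₁ X₂ : Eu d₁ → Eu d₁} {M₁ M₂ : Eu d₁ → Eu d₁ →L[ℝ] Eu d₁}
    (hX₁ : Continuous X₁) (hX₂ : Continuous X₂) (hM₁ : Continuous M₁) (hM₂ : Continuous M₂)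
    (hR₁ : ∀ x, ‖M₁ x‖ ≤ R) (hR₂ : ∀ x, ‖M₂ x‖ ≤ R) (hX : ∀ x, ‖X₁ x - X₂ x‖ ≤ S)
    (hM : ∀ x, ‖M₁ x - M₂ x‖ ≤ S) :
    |(∫ p, inner ℝ (M₁ p.1 (b (X₁ p.1) a)) (ζ p) ∂(μ : Measure (Eu d₁ × Eu d₂))) -
      ∫ p, inner ℝ (M₂ p.1 (b (X₂ p.1) a)) (ζ p) ∂(μ : Measure (Eu d₁ × Eu d₂))| ≤
      (1 + R) * B * S * ∫ p, ‖ζ p‖ ∂(μ : Measure (Eu d₁ × Eu d₂)) := by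
  have hR0 : 0 ≤ R := (norm_nonneg _).trans (hR₁ 0)
  have hS0 : 0 ≤ S := (norm_nonneg _).trans (hX 0)
  have hint : ∀ {X : Eu d₁ → Eu d₁} {M : Eu d₁ → Eu d₁ →L[ℝ] Eu d₁}, Continuous X →
      Continuous M → (∀ x, ‖M x‖ ≤ R) →
      Integrable (fun p : Eu d₁ × Eu d₂ => (inner ℝ (M p.1 (b (X p.1) a)) (ζ p) : ℝ))
        (μ : Measure (Eu d₁ × Eu d₂)) := by
    intro X M hX hM hR
    refine (hζi.norm.const_mul (R * B)).mono'
      (((hM.clm_apply (hbc.comp hX)).comp continuous_fst).inner hζ).aestronglyMeasurable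
      (ae_of_all _ fun p => (norm_inner_le_norm (𝕜 := ℝ) _ _).trans ?_)
    exact mul_le_mul_of_nonneg_right (((M p.1).le_opNorm _).trans
      (mul_le_mul (hR _) (hB _) (norm_nonneg _) hR0)) (norm_nonneg _)
  rw [← integral_sub (hint hX₁ hM₁ hR₁) (hint hX₂ hM₂ hR₂), ← integral_const_mul]
  rw [← Real.norm_eq_abs]
  refine norm_integral_le_of_norm_le (hζi.norm.const_mul _) (ae_of_all _ fun p => ?_)
  rw [← inner_sub_left]
  refine (norm_inner_le_norm _ _).trans (mul_le_mul_of_nonneg_right ?_ (norm_nonneg _))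
  have hsplit : M₁ p.1 (b (X₁ p.1) a) - M₂ p.1 (b (X₂ p.1) a) =
      (M₁ p.1 - M₂ p.1) (b (X₁ p.1) a) + M₂ p.1 (b (X₁ p.1) a - b (X₂ p.1) a) := by
    rw [sub_apply, map_sub, sub_add_sub_cancel]
  rw [hsplit]
  calc _ ≤ S * B + R * (B * S) := by
        refine (norm_add_le _ _).trans (add_le_add ?_ ?_)
        · exact (ContinuousLinearMap.le_opNorm _ _).trans
            (mul_le_mul (hM _) (hB _) (norm_nonneg _) hS0)
        · refine (ContinuousLinearMap.le_opNorm _ _).trans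
            (mul_le_mul (hR₂ _) ((hBL _ _).trans ?_) (norm_nonneg _) hR0)
          gcongr
          exact hX _
    _ = _ := by ring

end MeanFieldResNet

end

open MeanFieldResNet in
theorem mainTheorem5 (d₁ d₂ d' : ℕ) (hd₁ : 1 ≤ d₁) (hd₂ : 1 ≤ d₂) (hd' : 1 ≤ d')
    (b : MeanFieldResNet.Eu d₁ → MeanFieldResNet.Eu d' → MeanFieldResNet.Eu d₁)
    (ℓ : MeanFieldResNet.Eu d' → ℝ)
    (L : MeanFieldResNet.Eu d₁ × MeanFieldResNet.Eu d₂ → ℝ)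
    (hb : MeanFieldResNet.RegularField b)
    (hℓ : MeanFieldResNet.RegularPotential ℓ)
    (hL : MeanFieldResNet.RegularCost L)
    (hdis : MeanFieldResNet.Discriminating b)
    (ε T t₀ : ℝ) (hε : 0 < ε) (ht₀ : t₀ ∈ Set.Ico 0 T)
    (γ₀ : ProbabilityMeasure (MeanFieldResNet.Eu d₁ × MeanFieldResNet.Eu d₂))
    (hγ₀ : MeanFieldResNet.FiniteMoment 3 γ₀)
    (ν₁ ν₂ : ℝ → ProbabilityMeasure (MeanFieldResNet.Eu d'))
    (γ₁ γ₂ : ℝ → ProbabilityMeasure (MeanFieldResNet.Eu d₁ × MeanFieldResNet.Eu d₂))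
    (u₁ u₂ : ℝ → MeanFieldResNet.Eu d₁ × MeanFieldResNet.Eu d₂ → ℝ)
    (h₁ : MeanFieldResNet.SolvesOptimalitySystem b ℓ L ε t₀ T γ₀ ν₁ γ₁ u₁)
    (h₂ : MeanFieldResNet.SolvesOptimalitySystem b ℓ L ε t₀ T γ₀ ν₂ γ₂ u₂)
    (hinit : ν₁ t₀ = ν₂ t₀) :
    (∀ t ∈ Set.Icc t₀ T, ν₁ t = ν₂ t) ∧
      (∀ t ∈ Set.Icc t₀ T, γ₁ t = γ₂ t ∧ ∀ p, u₁ t p = u₂ t p) := by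
  have hT : t₀ < T := ht₀.2
  have h0 : t₀ ∈ Icc t₀ T := ⟨le_rfl, hT.le⟩
  obtain ⟨B, hB0, -, hB, hB', -⟩ := hb.exists_bounds
  obtain ⟨C₁, hC₁⟩ := h₁.exists_linearPerturbation_energy hb hℓ hT.le
  obtain ⟨C₂, hC₂⟩ := h₂.exists_linearPerturbation_energy hb hℓ hT.le
  set C := max C₁ C₂
  replace hC₁ := fun t ht => (hC₁ t ht).mono (le_max_left C₁ C₂)
  replace hC₂ := fun t ht => (hC₂ t ht).mono (le_max_right C₁ C₂)
  obtain ⟨K, hK⟩ := hb.regularVectorField hℓ C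
  obtain ⟨Q, hQ0, hQ⟩ := LinearPerturbation.exists_gibbs_lipschitz hℓ C
  -- the energies, frozen outside `[t₀, T]`, and the vector fields they generate
  obtain ⟨f₁, hf₁t, hp₁, hfc₁⟩ := h₁.exists_energy_extension hb hT.le hC₁
  obtain ⟨v₁, A₁, hve₁, hAe₁, hv₁⟩ : ∃ v A, (∀ t x, v t x = ∫ a, b x a ∂gibbs (f₁ t)) ∧
      (∀ t x, A t x = ∫ a, derivX b x a ∂gibbs (f₁ t)) ∧ RegularVectorField v A K :=
    ⟨_, _, fun _ _ => rfl, fun _ _ => rfl, hK f₁ hp₁ hfc₁⟩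
  have hν₁ : ∀ t ∈ Icc t₀ T, (ν₁ t : Measure (Eu d')) = gibbs (f₁ t) := fun t ht => by
    rw [hf₁t t ht]
    exact h₁.control t ht
  have hvν₁ : ∀ t ∈ Icc t₀ T, ∀ x, v₁ t x = avg b x (ν₁ t) := fun t ht x => by
    rw [avg, hν₁ t ht, hve₁]
  obtain ⟨f₂, hf₂t, hp₂, hfc₂⟩ := h₂.exists_energy_extension hb hT.le hC₂
  obtain ⟨v₂, A₂, hve₂, hAe₂, hv₂⟩ : ∃ v A, (∀ t x, v t x = ∫ a, b x a ∂gibbs (f₂ t)) ∧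
      (∀ t x, A t x = ∫ a, derivX b x a ∂gibbs (f₂ t)) ∧ RegularVectorField v A K :=
    ⟨_, _, fun _ _ => rfl, fun _ _ => rfl, hK f₂ hp₂ hfc₂⟩
  have hν₂ : ∀ t ∈ Icc t₀ T, (ν₂ t : Measure (Eu d')) = gibbs (f₂ t) := fun t ht => by
    rw [hf₂t t ht]
    exact h₂.control t ht
  have hvν₂ : ∀ t ∈ Icc t₀ T, ∀ x, v₂ t x = avg b x (ν₂ t) := fun t ht x => by
    rw [avg, hν₂ t ht, hve₂]
  have hbc : ∀ a, Continuous fun x => b x a := fun a => (hb.contDiff_left a).continuous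
  have hbL : ∀ x y a, ‖b x a - b y a‖ ≤ B * Real.exp ‖a‖ * ‖x - y‖ := fun x y a =>
    convex_univ.norm_image_sub_le_of_norm_hasFDerivWithin_le
      (fun z _ => (hb.hasFDerivAt_left a z).hasFDerivWithinAt) (fun z _ => hB' z a)
      (mem_univ y) (mem_univ x)
  -- the initial gradients of the multipliers have the same conditional expectation given `x`
  have hζ₁ : Continuous (gradX (u₁ t₀)) := continuous_gradX (h₁.multiplier.contDiff t₀ h0)
  have hζ₂ : Continuous (gradX (u₂ t₀)) := continuous_gradX (h₂.multiplier.contDiff t₀ h0)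
  have hi₁ : Integrable (gradX (u₁ t₀)) (γ₀ : Measure (Eu d₁ × Eu d₂)) := by
    obtain ⟨G, -, hG, -⟩ := h₁.multiplier.exists_gradX_bounds hT.le
    exact hγ₀.integrable_of_linear_growth (by norm_num) hζ₁.aestronglyMeasurable (hG t₀ h0)
  have hi₂ : Integrable (gradX (u₂ t₀)) (γ₀ : Measure (Eu d₁ × Eu d₂)) := by
    obtain ⟨G, -, hG, -⟩ := h₂.multiplier.exists_gradX_bounds hT.le
    exact hγ₀.integrable_of_linear_growth (by norm_num) hζ₂.aestronglyMeasurable (hG t₀ h0)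
  have hfinit : f₁ t₀ = f₂ t₀ := by
    refine LinearPerturbation.eq_of_gibbs_eq hℓ (hp₁ t₀) (hp₂ t₀) ?_ ?_
    · rw [← hν₁ t₀ h0, ← hν₂ t₀ h0, hinit]
    · rw [hf₁t t₀ h0, hf₂t t₀ h0]
      simp [energy, hb.zero]
  have hmom : ∀ a, ∫ p, inner ℝ (b p.1 a) (gradX (u₁ t₀) p) ∂(γ₀ : Measure (Eu d₁ × Eu d₂)) =
      ∫ p, inner ℝ (b p.1 a) (gradX (u₂ t₀) p) ∂(γ₀ : Measure (Eu d₁ × Eu d₂)) := by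
    intro a
    have := congrFun hfinit a
    rw [hf₁t t₀ h0, hf₂t t₀ h0, energy, energy, h₁.curve.initial, h₂.curve.initial] at this
    exact mul_left_cancel₀ (one_div_ne_zero hε.ne') (add_left_cancel this)
  have hE₁ : ∀ t ∈ Icc t₀ T, ∀ a, f₁ t a = ℓ a + 1 / ε * ∫ p,
      inner ℝ (hv₁.invDeriv t₀ t p.1 (b (hv₁.flow t₀ t p.1) a)) (gradX (u₁ t₀) p)
        ∂(γ₀ : Measure (Eu d₁ × Eu d₂)) := fun t ht a => by
    rw [hf₁t t ht, h₁.energy_eq hb hT hv₁ hvν₁ ht]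
  -- in the second energy, the gradient of the first multiplier can be used
  have hE₂ : ∀ t ∈ Icc t₀ T, ∀ a, f₂ t a = ℓ a + 1 / ε * ∫ p,
      inner ℝ (hv₂.invDeriv t₀ t p.1 (b (hv₂.flow t₀ t p.1) a)) (gradX (u₁ t₀) p)
        ∂(γ₀ : Measure (Eu d₁ × Eu d₂)) := fun t ht a => by
    rw [hf₂t t ht, h₂.energy_eq hb hT hv₂ hvν₂ ht]
    congr 2
    exact (hdis.integral_inner_eq hbc (fun a => ⟨_, fun x => hB x a⟩) hζ₁ hζ₂ hi₁ hi₂ hmom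
      (w := fun x => hv₂.invDeriv t₀ t x (b (hv₂.flow t₀ t x) a))
      ((hv₂.continuous_invDeriv_right t₀ t).clm_apply ((hbc a).comp (hv₂.continuous_flow_right t₀ t)))
      (B := Real.exp (K * |t - t₀|) * (B * Real.exp ‖a‖)) fun x =>
        (ContinuousLinearMap.le_opNorm _ _).trans (mul_le_mul (hv₂.norm_invDeriv_le _ _ _)
          (hB _ _) (norm_nonneg _) (Real.exp_pos _).le)).symm
  set Z := ∫ p, ‖gradX (u₁ t₀) p‖ ∂(γ₀ : Measure (Eu d₁ × Eu d₂)) with hZ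
  have hZ0 : 0 ≤ Z := integral_nonneg fun _ => norm_nonneg _
  set R := Real.exp (K * (T - t₀)) with hR
  set H := 1 / ε * ((1 + R) * B * Z) with hH
  have hflow := hv₁.flow_eq_of_closed_loop hv₂ (t₀ := t₀) (T := T) (H := Q * B * H)
    (by positivity) (fun t ht S hS x => by
      have hexp : Real.exp (K * |t - t₀|) ≤ R := by
        rw [abs_of_nonneg (sub_nonneg.2 ht.1)]
        have := hv₁.nonneg
        exact Real.exp_le_exp.2 (by gcongr; exact ht.2)
      have hΔ : ∀ a, |f₁ t a - f₂ t a| ≤ H * S * Real.exp ‖a‖ := by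
        intro a
        rw [hE₁ t ht, hE₂ t ht, add_sub_add_left_eq_sub, ← mul_sub, abs_mul,
          abs_of_pos (one_div_pos.2 hε)]
        have := abs_integral_inner_sub_le (hbc a) (fun x => hB x a) (by positivity)
          (fun x y => hbL x y a) hζ₁ hi₁ (hv₁.continuous_flow_right t₀ t)
          (hv₂.continuous_flow_right t₀ t) (hv₁.continuous_invDeriv_right t₀ t)
          (hv₂.continuous_invDeriv_right t₀ t)
          (fun x => (hv₁.norm_invDeriv_le t₀ t x).trans hexp)
          (fun x => (hv₂.norm_invDeriv_le t₀ t x).trans hexp)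
          (fun x => (hS x).1) (fun x => (hS x).2)
        refine (mul_le_mul_of_nonneg_left this (one_div_pos.2 hε).le).trans (le_of_eq ?_)
        rw [hH, hZ]
        ring
      have hx : Continuous (b x) := hb.contDiff.continuous.comp
        (continuous_const.prodMk continuous_id)
      have hx' : Continuous (derivX b x) := hb.continuous_derivX.comp
        (continuous_const.prodMk continuous_id)
      rw [mul_assoc (Q * B)]
      rw [hve₁, hve₂, hAe₁, hAe₂]
      exact ⟨(hQ _ _ (hp₁ t) (hp₂ t) _ hΔ _ _ _ hx (hB x)).2,
        (hQ _ _ (hp₁ t) (hp₂ t) _ hΔ _ _ _ hx' (hB' x)).2⟩)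
  refine ⟨fun t ht => Subtype.ext ?_, fun t ht => ⟨Subtype.ext ?_, fun p => ?_⟩⟩
  · have : f₁ t = f₂ t := by
      funext a
      rw [hE₁ t ht, hE₂ t ht]
      simp only [(hflow t ht _).1, (hflow t ht _).2]
    exact (hν₁ t ht).trans ((congrArg gibbs this).trans (hν₂ t ht).symm)
  · refine (h₁.curve.eq_map_flow hv₁ hvν₁ ht).trans
      (Eq.trans ?_ (h₂.curve.eq_map_flow hv₂ hvν₂ ht).symm)
    congr 1
    funext p
    rw [(hflow t ht _).1]
  · obtain ⟨x, y⟩ := p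
    have hTT : T ∈ Icc t₀ T := ⟨hT.le, le_rfl⟩
    have hx₁ : hv₁.flow t₀ t (hv₁.flow t t₀ x) = x := by rw [hv₁.flow_flow, hv₁.flow_self]
    have hx₂ : hv₂.flow t₀ t (hv₁.flow t t₀ x) = x := by rw [← (hflow t ht _).1, hx₁]
    have e₁ := (h₁.multiplier.apply_flow hT hv₁ hvν₁ ht (hv₁.flow t t₀ x) y).trans
      (h₁.multiplier.apply_flow hT hv₁ hvν₁ hTT (hv₁.flow t t₀ x) y).symm
    have e₂ := (h₂.multiplier.apply_flow hT hv₂ hvν₂ ht (hv₁.flow t t₀ x) y).trans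
      (h₂.multiplier.apply_flow hT hv₂ hvν₂ hTT (hv₁.flow t t₀ x) y).symm
    rw [hx₁, h₁.multiplier.equation T hTT, intervalIntegral.integral_same, add_zero] at e₁
    rw [hx₂, h₂.multiplier.equation T hTT, intervalIntegral.integral_same, add_zero] at e₂
    rw [e₁, e₂, (hflow T hTT _).1]
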